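/- Let $M$ be a smooth (finite-dimensional) manifold and let $(M,\omega)$ be pre-$n$-plectic, i.e. $\omega\in\Omega^{n+1}(M)$ is closed. Let $H\in\Omega^{n-1}(M)$ be a Hamiltonian form, i.e. there is a vector field $v_H$ (a Hamiltonian vector field of $H$) with $dH=-\iota_{v_H}\omega$. Let $\mathfrak g$ be a real Lie algebra and let $\mathfrak g\to\mathfrak X(M)$, $x\mapsto v_x$, be a homomorphism of Lie algebras with $\mathcal L_{v_x}\omega=0$ for all $x\in\mathfrak g$, which is locally $H$-preserving: $\mathcal L_{v_x}H$ is closed for all $x\in\mathfrak g$. Notation. For $p=x_1\wedge\dots\wedge x_k\in\Lambda^k\mathfrak g$ put $v_p=v_{x_1}\wedge\dots\wedge v_{x_k}$ and $\iota(v_p)=\iota_{v_{x_k}}\cdots\iota_{v_{x_1}}$, extended linearly to $\Lambda^k\mathfrak g$. For an $m$-vector field $Y$ and a form $\alpha$ put $\mathcal L_Y\alpha=d\iota_Y\alpha-(-1)^m\iota_Yd\alpha$. Let $\partial\colon\Lambda^k\mathfrak g\to\Lambda^{k-1}\mathfrak g$, $x_1\wedge\dots\wedge x_k\mapsto\sum_{i<j}(-1)^{i+j}[x_i,x_j]\wedge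 x_1\wedge\dots\hat x_i\dots\hat x_j\dots\wedge x_k$, be the Lie algebra homology differential, with cycles $Z_k(\mathfrak g)=\ker\partial|_{\Lambda^k\mathfrak g}$, boundaries $B_k(\mathfrak g)=\partial(\Lambda^{k+1}\mathfrak g)$ and homology $H_k(\mathfrak g)=Z_k(\mathfrak g)/B_k(\mathfrak g)$. Put $\varsigma(k)=-(-1)^{k(k+1)/2}$. A (homotopy) co-momentum map is a family of linear maps $f_i\colon\Lambda^i\mathfrak g\to\Omega^{n-i}(M)$, $1\le i\le n$, such that every $f_1(x)$ is Hamiltonian with $d f_1(x)=-\iota_{v_x}\omega$ and $$-f_{k-1}(\partial p)=df_k(p)+\varsigma(k)\,\iota(v_p)\omega\qquad\text{for all }1\le k\le n+1,\ p\in\Lambda^k\mathfrak g,$$ where $f_0=0$ and $f_{n+1}=0$. Forms of negative degree are zero, and we also put $f_i=0$ for $i>n$. Claim. For every $k\ge1$ the following hold. 1. The map $$A\colon H_k(\mathfrak g)\to H^{n-k}_{dR}(M),\qquad [p]\mapsto[\mathcal L_{v_p}H],$$ is well defined and linear: $\mathcal L_{v_p}H$ is a closed $(n-k)$-form for every $p\in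 Z_k(\mathfrak g)$, and its class depends only on $[p]$. 2. If $(f_i)$ is a co-momentum map for the action and $v_H$ is any Hamiltonian vector field of $H$, then for every $p\in Z_k(\mathfrak g)$ the form $\mathcal L_{v_H}f_k(p)$ is closed and $$A([p])=-\varsigma(k)\,[\mathcal L_{v_H}f_k(p)].$$ -/

import Mathlib

open scoped Manifold ContDiff Topology

noncomputable section

namespace MultiSymp

/-- The quotient `Z / (B ∩ Z)` of two subspaces of a real vector space. -/
abbrev Subquotient {V : Type*} [AddCommGroup V] [Module ℝ V] (Z B : Submodule ℝ V) : Type _ :=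
  Z ⧸ B.submoduleOf Z

/-- The class in `Z / (B ∩ Z)` of an element of `Z`. -/
def Subquotient.mk {V : Type*} [AddCommGroup V] [Module ℝ V] {Z B : Submodule ℝ V} :
    Z →ₗ[ℝ] Subquotient Z B :=
  Submodule.mkQ _

/-! ### Lie algebra homology -/

section LieHomology

variable (𝔤 : Type*) [LieRing 𝔤] [LieAlgebra ℝ 𝔤]

/-- The alternating map
`(x₁, …, x_{k+2}) ↦ ∑_{i<j} (-1)^{i+j} [xᵢ, xⱼ] ∧ x₁ ∧ ⋯ x̂ᵢ ⋯ x̂ⱼ ⋯ ∧ x_{k+2}`.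
It is obtained by alternating `(x, y; z) ↦ [x, y] ∧ z` in `x` and `y`; the factor `1/2` appears
because every pair is counted twice. The explicit formula is `boundaryAlt_apply`. -/
def boundaryAlt (k : ℕ) : 𝔤 [⋀^Fin (k + 2)]→ₗ[ℝ] (⋀[ℝ]^(k + 1) 𝔤) :=
  (-(1 / 2) : ℝ) •
    AlternatingMap.alternatizeUncurryFin (AlternatingMap.alternatizeUncurryFinLM ∘ₗ
      LinearMap.compr₂ (LieModule.toEnd ℝ 𝔤 𝔤 : 𝔤 →ₗ[ℝ] 𝔤 →ₗ[ℝ] 𝔤)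
        (AlternatingMap.curryLeft (exteriorPower.ιMulti ℝ (k + 1))))

theorem boundaryAlt_aux {V : Type*} [AddCommGroup V] [Module ℝ V] (l : ℕ) (y : V) :
    (-(1 / 2) : ℝ) • ((-1 : ℤ) ^ l • ((2 : ℝ) • y)) = -((-1 : ℝ) ^ l • y) := by
  rcases Nat.even_or_odd l with hp | hp
  · rw [hp.neg_one_pow, hp.neg_one_pow]
    module
  · rw [hp.neg_one_pow, hp.neg_one_pow]
    module

/-- The explicit formula. The index pair `(i, j)`, `i ≤ j`, stands for the positions
`i.castSucc < j.succ`, numbered from `0`; numbered from `1` they are `i + 1` and `j + 2`,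
whence the global minus sign. -/
theorem boundaryAlt_apply (k : ℕ) (x : Fin (k + 2) → 𝔤) :
    boundaryAlt 𝔤 k x =
      -∑ i : Fin (k + 1), ∑ j ≥ i, (-1 : ℝ) ^ (i + j : ℕ) •
        exteriorPower.ιMulti ℝ (k + 1)
          (Matrix.vecCons ⁅x i.castSucc, x j.succ⁆ (j.removeNth (i.castSucc.removeNth x))) := by
  rw [boundaryAlt, AlternatingMap.smul_apply,
    AlternatingMap.alternatizeUncurryFin_alternatizeUncurryFinLM_comp_apply,
    Finset.smul_sum, ← Finset.sum_neg_distrib]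
  refine Finset.sum_congr rfl fun i _ => ?_
  rw [Finset.smul_sum, ← Finset.sum_neg_distrib]
  refine Finset.sum_congr rfl fun j _ => ?_
  have h : ∀ (a b : 𝔤) (z : Fin k → 𝔤),
      (LinearMap.compr₂ (LieModule.toEnd ℝ 𝔤 𝔤 : 𝔤 →ₗ[ℝ] 𝔤 →ₗ[ℝ] 𝔤)
        (AlternatingMap.curryLeft (exteriorPower.ιMulti ℝ (k + 1)))) a b z =
      exteriorPower.ιMulti ℝ (k + 1) (Matrix.vecCons ⁅a, b⁆ z) := fun a b z => rfl
  have h2 : ∀ (a b : 𝔤) (z : Fin k → 𝔤),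
      exteriorPower.ιMulti ℝ (k + 1) (Matrix.vecCons ⁅b, a⁆ z) =
        -exteriorPower.ιMulti ℝ (k + 1) (Matrix.vecCons ⁅a, b⁆ z) := by
    intro a b z
    have h3 : ⁅b, a⁆ = -⁅a, b⁆ := (lie_skew b a).symm
    change AlternatingMap.curryLeft (exteriorPower.ιMulti ℝ (k + 1)) ⁅b, a⁆ z =
      -AlternatingMap.curryLeft (exteriorPower.ιMulti ℝ (k + 1)) ⁅a, b⁆ z
    rw [h3, map_neg]
    rfl
  rw [h, h, h2 (x i.castSucc) (x j.succ), sub_neg_eq_add, ← two_smul ℝ]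
  exact boundaryAlt_aux _ _

/-- The Lie algebra homology differential `∂_{k+1} : Λ^{k+1} 𝔤 → Λ^k 𝔤`; in particular `∂₁ = 0`. -/
def boundary : (k : ℕ) → (⋀[ℝ]^(k + 1) 𝔤) →ₗ[ℝ] (⋀[ℝ]^k 𝔤)
  | 0 => 0
  | k + 1 => exteriorPower.alternatingMapLinearEquiv (boundaryAlt 𝔤 k)

/-- The cycles `Z_k(𝔤) = ker ∂_k`, where `∂₀ = 0`. -/
def cycles : (k : ℕ) → Submodule ℝ (⋀[ℝ]^k 𝔤)
  | 0 => ⊤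
  | k + 1 => LinearMap.ker (boundary 𝔤 k)

/-- The boundaries `B_k(𝔤) = im ∂_{k+1}`. -/
def boundaries (k : ℕ) : Submodule ℝ (⋀[ℝ]^k 𝔤) :=
  LinearMap.range (boundary 𝔤 k)

/-- The Lie algebra homology `H_k(𝔤) = Z_k(𝔤) / B_k(𝔤)`. -/
abbrev LieHomology (k : ℕ) : Type _ :=
  Subquotient (cycles 𝔤 k) (boundaries 𝔤 k)

end LieHomology

/-! ### Contraction of a multivector with an alternating form -/

section Contraction

variable {V : Type*} [AddCommGroup V] [Module ℝ V] [TopologicalSpace V]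

theorem append_update_left {X : Type*} {m q : ℕ} [DecidableEq (Fin m)] (y : Fin m → X)
    (w : Fin q → X) (i : Fin m) (a : X) :
    Fin.append (Function.update y i a) w = Function.update (Fin.append y w) (Fin.castAdd q i) a := by
  ext l
  refine Fin.addCases (fun l => ?_) (fun l => ?_) l
  · by_cases h : l = i
    · subst h; simp
    · simp [Function.update_of_ne h, Function.update_of_ne (a := Fin.castAdd q l)
        (a' := Fin.castAdd q i) (by simpa using h)]
  · have : Fin.natAdd m l ≠ Fin.castAdd q i := by
      intro h; have := congrArg Fin.val h; simp at this; omega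
    simp [Function.update_of_ne this]

theorem append_update_right {X : Type*} {m q : ℕ} [DecidableEq (Fin q)] (y : Fin m → X)
    (w : Fin q → X) (i : Fin q) (a : X) :
    Fin.append y (Function.update w i a) = Function.update (Fin.append y w) (Fin.natAdd m i) a := by
  ext l
  refine Fin.addCases (fun l => ?_) (fun l => ?_) l
  · have : Fin.castAdd q l ≠ Fin.natAdd m i := by
      intro h; have := congrArg Fin.val h; simp at this; omega
    simp [Function.update_of_ne this]
  · by_cases h : l = i
    · subst h; simp
    · simp [Function.update_of_ne h, Function.update_of_ne (a := Fin.natAdd m l)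
        (a' := Fin.natAdd m i) (by simpa using h)]

/-- `(y₁, …, y_m) ↦ ι_{y_m} ⋯ ι_{y₁} α = α(y₁, …, y_m, ·, …, ·)`. -/
def contractAlt {m q : ℕ} (α : V [⋀^Fin (m + q)]→L[ℝ] ℝ) :
    V [⋀^Fin m]→ₗ[ℝ] (V [⋀^Fin q]→L[ℝ] ℝ) where
  toFun y :=
    { toFun := fun w => α (Fin.append y w)
      map_update_add' := by
        intro _ w i a b
        simp only [append_update_right]
        exact α.map_update_add _ _ _ _
      map_update_smul' := by
        intro _ w i c a
        simp only [append_update_right]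
        exact α.map_update_smul _ _ _ _
      map_eq_zero_of_eq' := by
        intro w i j hw hij
        refine α.map_eq_zero_of_eq _ (i := Fin.natAdd m i) (j := Fin.natAdd m j) ?_ ?_
        · simpa using hw
        · simpa using hij
      cont := by
        refine α.cont.comp (continuous_pi fun l => ?_)
        refine Fin.addCases (fun l => ?_) (fun l => ?_) l
        · simpa using continuous_const
        · simpa using continuous_apply l }
  map_update_add' := by
    intro _ y i a b
    ext w
    change α _ = α _ + α _
    simp only [append_update_left]
    exact α.map_update_add _ _ _ _
  map_update_smul' := by
    intro _ y i c a
    ext w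
    change α _ = c • α _
    simp only [append_update_left]
    exact α.map_update_smul _ _ _ _
  map_eq_zero_of_eq' := by
    intro y i j hy hij
    ext w
    refine α.map_eq_zero_of_eq _ (i := Fin.castAdd q i) (j := Fin.castAdd q j) ?_ ?_
    · simpa using hy
    · simpa using hij

/-- The contraction `ι_Y α` with `Y ∈ Λ^m V`, extended linearly from
`ι(y₁ ∧ ⋯ ∧ y_m) = ι_{y_m} ⋯ ι_{y₁}`. -/
def contract {m q : ℕ} (Y : ⋀[ℝ]^m V) (α : V [⋀^Fin (m + q)]→L[ℝ] ℝ) : V [⋀^Fin q]→L[ℝ] ℝ :=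
  exteriorPower.alternatingMapLinearEquiv (contractAlt α) Y

end Contraction

/-! ### Differential forms on a manifold -/

section Forms

variable (E : Type*) [NormedAddCommGroup E] [NormedSpace ℝ E]
  (M : Type*) [TopologicalSpace M] [ChartedSpace E M]

/-- A (not necessarily smooth) differential form of degree `q` on `M`. -/
abbrev RawForm (q : ℕ) : Type _ :=
  (x : M) → (TangentSpace 𝓘(ℝ, E) x) [⋀^Fin q]→L[ℝ] ℝ

/-- A (not necessarily smooth) inhomogeneous differential form on `M`: the family of its
homogeneous components. -/
abbrev TotalForm : Type _ := (q : ℕ) → RawForm E M q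

variable {E M}

/-- The expression of a form in the preferred chart at `x₀`: the pull-back of the form by the
inverse of that chart. It is meaningful on the target of the chart. -/
def chartRep {q : ℕ} (α : RawForm E M q) (x₀ : M) (y : E) : E [⋀^Fin q]→L[ℝ] ℝ :=
  (α ((extChartAt 𝓘(ℝ, E) x₀).symm y)).compContinuousLinearMap
    (mfderiv 𝓘(ℝ, E) 𝓘(ℝ, E) (extChartAt 𝓘(ℝ, E) x₀).symm y)

/-- Smoothness of a form: smoothness of its expressions in charts. -/
def IsSmoothForm {q : ℕ} (α : RawForm E M q) : Prop :=
  ∀ x₀ : M, ContDiffOn ℝ ∞ (chartRep α x₀) (extChartAt 𝓘(ℝ, E) x₀).target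

/-- The exterior derivative of a `q`-form, computed at `x` in the preferred chart at `x`. -/
def rawExtDeriv {q : ℕ} (α : RawForm E M q) : RawForm E M (q + 1) := fun x =>
  (extDeriv (chartRep α x) (extChartAt 𝓘(ℝ, E) x x)).compContinuousLinearMap
    (mfderiv 𝓘(ℝ, E) 𝓘(ℝ, E) (extChartAt 𝓘(ℝ, E) x) x)

/-- The exterior derivative `d` of an inhomogeneous form. -/
def dForm (α : TotalForm E M) : TotalForm E M
  | 0 => 0
  | q + 1 => rawExtDeriv (α q)

theorem chartRep_add {q : ℕ} (α β : RawForm E M q) (x₀ : M) :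
    chartRep (α + β) x₀ = chartRep α x₀ + chartRep β x₀ := rfl

theorem chartRep_smul {q : ℕ} (c : ℝ) (α : RawForm E M q) (x₀ : M) :
    chartRep (c • α) x₀ = c • chartRep α x₀ := rfl

theorem IsSmoothForm.differentiableAt {q : ℕ} {α : RawForm E M q} (h : IsSmoothForm α) (x : M) :
    DifferentiableAt ℝ (chartRep α x) (extChartAt 𝓘(ℝ, E) x x) :=
  ((h x).contDiffAt ((isOpen_extChartAt_target x).mem_nhds (mem_extChartAt_target x))
    ).differentiableAt (by simp)

theorem rawExtDeriv_add {q : ℕ} {α β : RawForm E M q} (hα : IsSmoothForm α)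
    (hβ : IsSmoothForm β) : rawExtDeriv (α + β) = rawExtDeriv α + rawExtDeriv β := by
  funext x
  simp only [rawExtDeriv, Pi.add_apply, chartRep_add]
  rw [extDeriv_add (hα.differentiableAt x) (hβ.differentiableAt x)]
  rfl

theorem rawExtDeriv_smul {q : ℕ} (c : ℝ) (α : RawForm E M q) :
    rawExtDeriv (c • α) = c • rawExtDeriv α := by
  funext x
  simp only [rawExtDeriv, Pi.smul_apply, chartRep_smul]
  rw [extDeriv_smul]
  rfl

theorem dForm_add {α β : TotalForm E M} (hα : ∀ q, IsSmoothForm (α q))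
    (hβ : ∀ q, IsSmoothForm (β q)) : dForm (α + β) = dForm α + dForm β := by
  funext q
  cases q with
  | zero => exact (add_zero (0 : RawForm E M 0)).symm
  | succ q => exact rawExtDeriv_add (hα q) (hβ q)

theorem dForm_smul (c : ℝ) (α : TotalForm E M) : dForm (c • α) = c • dForm α := by
  funext q
  cases q with
  | zero => exact (smul_zero c (A := RawForm E M 0)).symm
  | succ q => exact rawExtDeriv_smul c (α q)

theorem dForm_zero : dForm (0 : TotalForm E M) = 0 := by
  simpa using dForm_smul 0 (0 : TotalForm E M)

variable (E M) in
/-- The space `Ω^j(M)` of smooth differential forms of degree `j ∈ ℤ`, as the subspace of those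
inhomogeneous forms that are smooth and concentrated in degree `j`. It is zero for `j < 0`. -/
def Omega (j : ℤ) : Submodule ℝ (TotalForm E M) where
  carrier := {α | (∀ q, IsSmoothForm (α q)) ∧ ∀ q : ℕ, (q : ℤ) ≠ j → α q = 0}
  add_mem' := by
    rintro α β ⟨h1, h2⟩ ⟨h3, h4⟩
    refine ⟨fun q x₀ => ?_, fun q hq => ?_⟩
    · exact (h1 q x₀).add (h3 q x₀)
    · rw [Pi.add_apply, h2 q hq, h4 q hq, add_zero]
  zero_mem' := ⟨fun _ _ => contDiffOn_const (c := 0), fun _ _ => rfl⟩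
  smul_mem' := by
    rintro c α ⟨h1, h2⟩
    refine ⟨fun q x₀ => ?_, fun q hq => ?_⟩
    · exact (h1 q x₀).const_smul c
    · rw [Pi.smul_apply, h2 q hq, smul_zero]

variable (E M) in
/-- The closed forms of degree `j`. -/
def closedForms (j : ℤ) : Submodule ℝ (TotalForm E M) where
  carrier := {α | α ∈ Omega E M j ∧ dForm α = 0}
  add_mem' := by
    rintro α β ⟨h1, h2⟩ ⟨h3, h4⟩
    exact ⟨add_mem h1 h3, by rw [dForm_add h1.1 h3.1, h2, h4, add_zero]⟩
  zero_mem' := ⟨zero_mem _, dForm_zero⟩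
  smul_mem' := by
    rintro c α ⟨h1, h2⟩
    exact ⟨Submodule.smul_mem _ c h1, by rw [dForm_smul, h2, smul_zero]⟩

variable (E M) in
/-- The exact forms of degree `j`. -/
def exactForms (j : ℤ) : Submodule ℝ (TotalForm E M) where
  carrier := {α | ∃ β ∈ Omega E M (j - 1), dForm β = α}
  add_mem' := by
    rintro _ _ ⟨α, h1, rfl⟩ ⟨β, h3, rfl⟩
    exact ⟨α + β, add_mem h1 h3, dForm_add h1.1 h3.1⟩
  zero_mem' := ⟨0, zero_mem _, dForm_zero⟩
  smul_mem' := by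
    rintro c _ ⟨α, h1, rfl⟩
    exact ⟨c • α, Submodule.smul_mem _ c h1, dForm_smul c α⟩

variable (E M) in
/-- The de Rham cohomology `H^j_dR(M)`, `j ∈ ℤ`. -/
abbrev DeRham (j : ℤ) : Type _ :=
  Subquotient (closedForms E M j) (exactForms E M j)

/-! ### Multivector fields, contractions and Lie derivatives -/

variable (E M) in
/-- The smooth vector fields on `M`. -/
abbrev VectorFields [IsManifold 𝓘(ℝ, E) ∞ M] : Type _ :=
  Cₛ^∞⟮𝓘(ℝ, E); E, (TangentSpace 𝓘(ℝ, E) : M → Type _)⟯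

variable (E M) in
/-- The (not necessarily smooth) `m`-vector fields on `M`. -/
abbrev MultivectorField (m : ℕ) : Type _ := (x : M) → ⋀[ℝ]^m (TangentSpace 𝓘(ℝ, E) x)

/-- A vector field as a `1`-vector field. -/
def toMultivector (X : (x : M) → TangentSpace 𝓘(ℝ, E) x) : MultivectorField E M 1 := fun x =>
  exteriorPower.ιMulti ℝ 1 ![X x]

/-- The contraction `ι_Y α` of a differential form with an `m`-vector field. -/
def iota {m : ℕ} (Y : MultivectorField E M m) (α : TotalForm E M) : TotalForm E M := fun q x =>
  contract (Y x) (α (m + q) x)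

/-- The Lie derivative `𝓛_Y α = d ι_Y α - (-1)^m ι_Y dα` along an `m`-vector field. For `m = 1`
this is Cartan's formula for the usual Lie derivative. -/
def lieDer {m : ℕ} (Y : MultivectorField E M m) (α : TotalForm E M) : TotalForm E M :=
  dForm (iota Y α) - (-1 : ℝ) ^ m • iota Y (dForm α)

end Forms

/-! ### Pre-`n`-plectic manifolds, actions and co-momentum maps -/

section Plectic

variable {E : Type*} [NormedAddCommGroup E] [NormedSpace ℝ E]
  {M : Type*} [TopologicalSpace M] [ChartedSpace E M] [IsManifold 𝓘(ℝ, E) ∞ M]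
  {𝔤 : Type*} [LieRing 𝔤] [LieAlgebra ℝ 𝔤]

/-- `(M, ω₀)` is a pre-`n`-plectic manifold: `ω₀` is a closed `(n+1)`-form. -/
def IsPrePlectic (n : ℕ) (ω₀ : TotalForm E M) : Prop := ω₀ ∈ closedForms E M (n + 1)

/-- `X` is a Hamiltonian vector field for the form `α`: `dα = -ι_X ω₀`. -/
def IsHamiltonianVectorField (ω₀ α : TotalForm E M) (X : VectorFields E M) : Prop :=
  dForm α = -iota (toMultivector X) ω₀

/-- `α` is a Hamiltonian `(n-1)`-form. -/
def IsHamiltonianForm (n : ℕ) (ω₀ α : TotalForm E M) : Prop :=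
  α ∈ Omega E M (n - 1) ∧ ∃ X : VectorFields E M, IsHamiltonianVectorField ω₀ α X

variable (E M 𝔤) in
/-- An infinitesimal action of `𝔤` on `M`: a homomorphism of Lie algebras from `𝔤` to the smooth
vector fields on `M`. -/
structure InfinitesimalAction where
  /-- The vector field `v_a` of `a ∈ 𝔤`. -/
  field : 𝔤 →ₗ[ℝ] VectorFields E M
  map_lie : ∀ (a b : 𝔤) (x : M),
    field ⁅a, b⁆ x = VectorField.mlieBracket 𝓘(ℝ, E) (field a) (field b) x

namespace InfinitesimalAction

/-- The linear map `𝔤 → T_x M`, `a ↦ v_a(x)`. -/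
def at' (v : InfinitesimalAction E M 𝔤) (x : M) : 𝔤 →ₗ[ℝ] TangentSpace 𝓘(ℝ, E) x where
  toFun a := v.field a x
  map_add' a b := by rw [map_add]; rfl
  map_smul' c a := by rw [map_smul]; rfl

/-- The multivector field `v_p`, `p ∈ Λ^k 𝔤`, with `v_p = v_{a₁} ∧ ⋯ ∧ v_{a_k}` for
`p = a₁ ∧ ⋯ ∧ a_k`. -/
def multi (v : InfinitesimalAction E M 𝔤) {k : ℕ} (p : ⋀[ℝ]^k 𝔤) : MultivectorField E M k :=
  fun x => exteriorPower.map k (v.at' x) p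

/-- The action is multisymplectic: `𝓛_{v_a} ω₀ = 0` for all `a ∈ 𝔤`. -/
def IsMultisymplectic (v : InfinitesimalAction E M 𝔤) (ω₀ : TotalForm E M) : Prop :=
  ∀ a : 𝔤, lieDer (toMultivector (v.field a)) ω₀ = 0

/-- The action is locally `H`-preserving: `𝓛_{v_a} H` is closed for all `a ∈ 𝔤`. -/
def IsLocallyPreserving (v : InfinitesimalAction E M 𝔤) (H : TotalForm E M) : Prop :=
  ∀ a : 𝔤, dForm (lieDer (toMultivector (v.field a)) H) = 0

end InfinitesimalAction

/-- The sign `ς(k) = -(-1)^{k(k+1)/2}`. -/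
def sgn (k : ℕ) : ℝ := -(-1) ^ (k * (k + 1) / 2)

/-- The components `f_i : Λ^i 𝔤 → Ω^{n-i}(M)` form an `L_∞`-morphism from `𝔤` to the Lie
`n`-algebra of observables of `(M, ω₀)`. Only the components with `1 ≤ i ≤ n` carry information:
`f₀ = 0` is imposed, and `f_i = 0` for `i > n` since there are no forms of negative degree. -/
structure IsLInftyMorphism (n : ℕ) (ω₀ : TotalForm E M) (v : InfinitesimalAction E M 𝔤)
    (f : (i : ℕ) → (⋀[ℝ]^i 𝔤) →ₗ[ℝ] Omega E M ((n : ℤ) - i)) : Prop where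
  f_zero : f 0 = 0
  isHamiltonianForm : ∀ p : ⋀[ℝ]^1 𝔤, IsHamiltonianForm n ω₀ (f 1 p : TotalForm E M)
  /-- `-f_{k-1}(∂ p) = d f_k(p) + ς(k) ι(v_p) ω₀` for `k = j + 1 ∈ {1, …, n + 1}`. -/
  main : ∀ j ≤ n, ∀ p : ⋀[ℝ]^(j + 1) 𝔤,
    -(f j (boundary 𝔤 j p) : TotalForm E M) =
      dForm (f (j + 1) p : TotalForm E M) + sgn (j + 1) • iota (v.multi p) ω₀

/-- `f` is a (homotopy) co-momentum map for the action `v` on `(M, ω₀)`. -/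
structure IsComomentum (n : ℕ) (ω₀ : TotalForm E M) (v : InfinitesimalAction E M 𝔤)
    (f : (i : ℕ) → (⋀[ℝ]^i 𝔤) →ₗ[ℝ] Omega E M ((n : ℤ) - i)) : Prop
    extends IsLInftyMorphism n ω₀ v f where
  /-- `d(f₁(a)) = -ι_{v_a} ω₀`. -/
  moment : ∀ a : 𝔤, IsHamiltonianVectorField ω₀
    (f 1 (exteriorPower.ιMulti ℝ 1 ![a]) : TotalForm E M) (v.field a)

end Plectic

end MultiSymp

end

/-!
For vector fields, Cartan's calculus gives `𝓛_X ι_Y = ι_Y 𝓛_X + ι_[X, Y]`. Since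
`𝓛_{b ∧ a} = (-1)^k (𝓛_b ι_a - ι_b 𝓛_a)` for `a ∈ Λ^k 𝔤`, induction on the degree yields
`𝓛_p α = (-1)^k ι_{∂p} α` for every form `α` annihilated by all `𝓛_{v_b}` and every `p ∈ Λ^k 𝔤`.
Local preservation of `H` says precisely that `α = dH` is such a form. Hence
`d 𝓛_p H = -(-1)^k 𝓛_p dH = -ι_{∂p} dH` vanishes on cycles, and
`𝓛_{∂p} H = d (ι_{∂p} H + ι_p dH)` is exact.

For a co-momentum map, `d f_k(p) = -ς(k) ι_p ω` on cycles. As `dH = -ι_{v_H} ω`, the terms in which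
`ω` is contracted with both `p` and `v_H` cancel in `𝓛_p H + ς(k) 𝓛_{v_H} f_k(p)`, and what is left
is `d (ι_p H + ς(k) ι_{v_H} f_k(p))`.
-/

noncomputable section

namespace MultiSymp

section LocalCalculus

variable {𝕜 E F : Type*} [NontriviallyNormedField 𝕜] [NormedAddCommGroup E] [NormedSpace 𝕜 E]
  [NormedAddCommGroup F] [NormedSpace 𝕜 F] {q : ℕ}

theorem removeNth_succ_vecCons {α : Type*} {n : ℕ} (i : Fin (n + 1)) (a : α)
    (w : Fin (n + 1) → α) :
    i.succ.removeNth (Matrix.vecCons a w) = Matrix.vecCons a (i.removeNth w) := by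
  funext j
  refine Fin.cases ?_ (fun j => ?_) j <;> simp [Fin.removeNth]

theorem neg_one_pow_smul_map_vecCons_removeNth {R V W : Type*} [CommRing R]
    [AddCommGroup V] [Module R V] [AddCommGroup W] [Module R W] (f : V [⋀^Fin (q + 1)]→ₗ[R] W)
    (a : V) (w : Fin (q + 1) → V) (i : Fin (q + 1)) :
    (-1) ^ (i : ℕ) • f (Matrix.vecCons a (i.removeNth w)) = f (Function.update w i a) := by
  rw [← f.map_insertNth, Fin.insertNth_removeNth]

variable (𝕜 E F) in
/-- `ContinuousAlternatingMap.curryLeft` as a continuous linear map. -/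
def curryLeftCLM (q : ℕ) : (E [⋀^Fin (q + 1)]→L[𝕜] F) →L[𝕜] (E →L[𝕜] E [⋀^Fin q]→L[𝕜] F) :=
  ContinuousAlternatingMap.curryLeftLI.toContinuousLinearMap

theorem hasFDerivAt_curryLeft {θ : E → E [⋀^Fin (q + 1)]→L[𝕜] F} {y : E}
    (hθ : DifferentiableAt 𝕜 θ y) :
    HasFDerivAt (fun z => (θ z).curryLeft) (curryLeftCLM 𝕜 E F q ∘L fderiv 𝕜 θ y) y :=
  HasFDerivAt.comp (g := curryLeftCLM 𝕜 E F q) y (curryLeftCLM 𝕜 E F q).hasFDerivAt hθ.hasFDerivAt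

theorem fderiv_curryLeft_apply {θ : E → E [⋀^Fin (q + 1)]→L[𝕜] F} {X : E → E} {y : E}
    (hθ : DifferentiableAt 𝕜 θ y) (hX : DifferentiableAt 𝕜 X y) (u : E) (w : Fin q → E) :
    fderiv 𝕜 (fun z => (θ z).curryLeft (X z)) y u w =
      fderiv 𝕜 θ y u (Matrix.vecCons (X y) w) + θ y (Matrix.vecCons (fderiv 𝕜 X y u) w) := by
  rw [((hasFDerivAt_curryLeft hθ).clm_apply hX.hasFDerivAt).fderiv, add_comm]
  rfl

theorem apply_vecCons_lieBracket (f : E [⋀^Fin (q + 1)]→L[𝕜] F) (X Y : E → E) (y : E)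
    (w : Fin q → E) :
    f (Matrix.vecCons (VectorField.lieBracket 𝕜 X Y y) w) =
      f (Matrix.vecCons (fderiv 𝕜 Y y (X y)) w) - f (Matrix.vecCons (fderiv 𝕜 X y (Y y)) w) := by
  change f.curryLeft (fderiv 𝕜 Y y (X y) - fderiv 𝕜 X y (Y y)) w = _
  rw [map_sub]
  rfl

theorem contDiffOn_extDeriv {m n : WithTop ℕ∞} {θ : E → E [⋀^Fin q]→L[𝕜] F} {s : Set E}
    (hs : IsOpen s) (hθ : ContDiffOn 𝕜 n θ s) (hmn : m + 1 ≤ n) : ContDiffOn 𝕜 m (extDeriv θ) s :=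
  ContDiff.comp_contDiffOn (g := ContinuousAlternatingMap.alternatizeUncurryFinCLM 𝕜 E F)
    (ContinuousLinearMap.contDiff _) (hθ.fderiv_of_isOpen hs hmn)

/-- The value at `w` of the Lie derivative at `y` of the form `θ` on a normed space along the
vector field `X`, by the formula
`(𝓛_X θ)(w₁, …, w_q) = X(θ)(w₁, …, w_q) + ∑ᵢ θ(w₁, …, DX(wᵢ), …, w_q)`. -/
def localLieDer (X : E → E) (θ : E → E [⋀^Fin q]→L[𝕜] F) (y : E) (w : Fin q → E) : F :=
  fderiv 𝕜 θ y (X y) w + ∑ i, θ y (Function.update w i (fderiv 𝕜 X y (w i)))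

theorem localLieDer_congr {θ θ' : E → E [⋀^Fin q]→L[𝕜] F} {y : E} (h : θ =ᶠ[𝓝 y] θ') (X : E → E)
    (w : Fin q → E) : localLieDer X θ y w = localLieDer X θ' y w := by
  rw [localLieDer, h.fderiv_eq, h.eq_of_nhds, localLieDer]

theorem extDeriv_vecCons_eq_localLieDer {θ : E → E [⋀^Fin 0]→L[𝕜] F} (X : E → E) (y : E)
    (w : Fin 0 → E) : extDeriv θ y (Matrix.vecCons (X y) w) = localLieDer X θ y w := by
  simp [extDeriv, localLieDer, ContinuousAlternatingMap.alternatizeUncurryFin_apply]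

theorem extDeriv_curryLeft_add_extDeriv_vecCons {θ : E → E [⋀^Fin (q + 1)]→L[𝕜] F} {X : E → E}
    {y : E} (hθ : DifferentiableAt 𝕜 θ y) (hX : DifferentiableAt 𝕜 X y) (w : Fin (q + 1) → E) :
    extDeriv (fun z => (θ z).curryLeft (X z)) y w + extDeriv θ y (Matrix.vecCons (X y) w) =
      localLieDer X θ y w := by
  have alternation (i : Fin (q + 1)) := neg_one_pow_smul_map_vecCons_removeNth
    (θ y).toAlternatingMap (fderiv 𝕜 X y (w i)) w i
  simp only [ContinuousAlternatingMap.coe_toAlternatingMap] at alternation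
  simp only [extDeriv, ContinuousAlternatingMap.alternatizeUncurryFin_apply,
    fderiv_curryLeft_apply hθ hX, localLieDer, ← alternation]
  rw [Fin.sum_univ_succ (n := q + 1)]
  simp only [smul_add, Finset.sum_add_distrib, Fin.coe_ofNat_eq_mod, Nat.zero_mod, pow_zero,
    Matrix.cons_val_zero, Fin.removeNth_zero, Fin.tail_vecCons, one_smul, Fin.val_succ, pow_succ,
    mul_neg, mul_one, Matrix.cons_val_succ, removeNth_succ_vecCons, neg_smul,
    Finset.sum_neg_distrib]
  abel

theorem localLieDer_curryLeft {θ : E → E [⋀^Fin (q + 1)]→L[𝕜] F} {X Y : E → E} {y : E}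
    (hθ : DifferentiableAt 𝕜 θ y) (hY : DifferentiableAt 𝕜 Y y) (w : Fin q → E) :
    localLieDer X (fun z => (θ z).curryLeft (Y z)) y w =
      localLieDer X θ y (Matrix.vecCons (Y y) w) +
        θ y (Matrix.vecCons (VectorField.lieBracket 𝕜 X Y y) w) := by
  rw [apply_vecCons_lieBracket]
  simp only [localLieDer, fderiv_curryLeft_apply hθ hY, Fin.sum_univ_succ (n := q),
    Matrix.vecCons, Fin.update_cons_zero, Fin.cons_zero, Fin.cons_succ, ← Fin.cons_update]
  simp only [ContinuousAlternatingMap.curryLeft_apply_apply, Matrix.vecCons, Fin.cons_update]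
  abel

end LocalCalculus

section Charts

variable {E : Type*} [NormedAddCommGroup E] [NormedSpace ℝ E]
  {M : Type*} [TopologicalSpace M] [ChartedSpace E M]

/-- The derivative of the inverse of the preferred chart at `x₀`, the tangent spaces of `M` being
identified with `E`. -/
def chartDiff (x₀ : M) (y : E) : E →L[ℝ] E :=
  mfderiv 𝓘(ℝ, E) 𝓘(ℝ, E) (extChartAt 𝓘(ℝ, E) x₀).symm y

/-- The expression of a vector field in the preferred chart at `x₀`. -/
def chartField (X : (x : M) → TangentSpace 𝓘(ℝ, E) x) (x₀ : M) (y : E) : E :=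
  VectorField.mpullback 𝓘(ℝ, E) 𝓘(ℝ, E) (extChartAt 𝓘(ℝ, E) x₀).symm X y

theorem compContinuousLinearMap_congr {q : ℕ} (α : RawForm E M q) {x x' : M} (hx : x = x')
    {L L' : E →L[ℝ] E} (hL : L = L') :
    ((α x).compContinuousLinearMap (L : E →L[ℝ] TangentSpace 𝓘(ℝ, E) x) : E [⋀^Fin q]→L[ℝ] ℝ) =
      (α x').compContinuousLinearMap (L' : E →L[ℝ] TangentSpace 𝓘(ℝ, E) x') := by
  subst hx hL
  rfl

variable [IsManifold 𝓘(ℝ, E) ∞ M]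

theorem isInvertible_mfderiv_extChartAt_symm {x₀ : M} {y : E}
    (hy : y ∈ (extChartAt 𝓘(ℝ, E) x₀).target) :
    (mfderiv 𝓘(ℝ, E) 𝓘(ℝ, E) (extChartAt 𝓘(ℝ, E) x₀).symm y).IsInvertible := by
  have h := isInvertible_mfderivWithin_extChartAt_symm (I := 𝓘(ℝ, E)) hy
  rwa [modelWithCornersSelf_coe, Set.range_id, mfderivWithin_univ] at h

theorem mdifferentiableAt_extChartAt_symm {x₀ : M} {y : E}
    (hy : y ∈ (extChartAt 𝓘(ℝ, E) x₀).target) :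
    MDifferentiableAt 𝓘(ℝ, E) 𝓘(ℝ, E) (extChartAt 𝓘(ℝ, E) x₀).symm y :=
  mdifferentiableAt_of_isInvertible_mfderiv (isInvertible_mfderiv_extChartAt_symm hy)

theorem chartDiff_self (x : M) : chartDiff x (extChartAt 𝓘(ℝ, E) x x) = .id ℝ E := by
  have h := mfderivWithin_range_extChartAt_symm (I := 𝓘(ℝ, E)) (x := x)
  rw [modelWithCornersSelf_coe, Set.range_id, mfderivWithin_univ] at h
  exact h

theorem chartDiff_chartField (X : (x : M) → TangentSpace 𝓘(ℝ, E) x) (x₀ : M) {y : E}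
    (hy : y ∈ (extChartAt 𝓘(ℝ, E) x₀).target) :
    chartDiff x₀ y (chartField X x₀ y) = X ((extChartAt 𝓘(ℝ, E) x₀).symm y) :=
  (isInvertible_mfderiv_extChartAt_symm hy).self_apply_inverse _

theorem chartField_self (X : (x : M) → TangentSpace 𝓘(ℝ, E) x) (x : M) :
    chartField X x (extChartAt 𝓘(ℝ, E) x x) = X x := by
  have h := chartDiff_chartField X x (mem_extChartAt_target x)
  rw [chartDiff_self] at h
  refine Eq.trans h ?_
  rw [extChartAt_to_inv]

theorem mlieBracket_eq_lieBracket_chartField (X Y : (x : M) → TangentSpace 𝓘(ℝ, E) x) (x : M) :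
    VectorField.mlieBracket 𝓘(ℝ, E) X Y x =
      VectorField.lieBracket ℝ (chartField X x) (chartField Y x) (extChartAt 𝓘(ℝ, E) x x) := by
  have inverse_apply_of_eq_id (L : E →L[ℝ] E) (hL : L = .id ℝ E) (u : E) : L.inverse u = u := by
    rw [hL, ContinuousLinearMap.inverse_id, ContinuousLinearMap.id_apply]
  refine (inverse_apply_of_eq_id _ mfderiv_extChartAt_self _).trans ?_
  simp only [modelWithCornersSelf_coe, Set.range_id, Set.preimage_univ, Set.inter_self,
    VectorField.mpullbackWithin_univ]
  exact congrFun (VectorField.lieBracketWithin_univ (V := chartField X x) (W := chartField Y x)) _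

theorem trivializationAt_apply_snd_eq_chartField (X : (x : M) → TangentSpace 𝓘(ℝ, E) x) (x₀ : M)
    {y : E} (hy : y ∈ (extChartAt 𝓘(ℝ, E) x₀).target) :
    (trivializationAt E (TangentSpace 𝓘(ℝ, E)) x₀
      ⟨(extChartAt 𝓘(ℝ, E) x₀).symm y, X ((extChartAt 𝓘(ℝ, E) x₀).symm y)⟩).2 =
      chartField X x₀ y := by
  have hx : (extChartAt 𝓘(ℝ, E) x₀).symm y ∈ (chartAt E x₀).source := by
    simpa only [extChartAt_source] using (extChartAt 𝓘(ℝ, E) x₀).map_target hy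
  have hleft := mfderiv_extChartAt_comp_mfderivWithin_extChartAt_symm (I := 𝓘(ℝ, E)) hy
  rw [modelWithCornersSelf_coe, Set.range_id, mfderivWithin_univ,
    ← TangentBundle.continuousLinearMapAt_trivializationAt hx] at hleft
  refine Eq.trans ?_ (congrArg (fun L : E →L[ℝ] E => L (chartField X x₀ y)) hleft)
  rw [← chartDiff_chartField X x₀ hy]
  exact (Bundle.Trivialization.continuousLinearMapAt_apply_of_mem ℝ _ (by simpa using hx) _).symm

theorem contDiffOn_chartField (X : VectorFields E M) (x₀ : M) :
    ContDiffOn ℝ ∞ (chartField X x₀) (extChartAt 𝓘(ℝ, E) x₀).target := by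
  have hX := (trivializationAt E (TangentSpace 𝓘(ℝ, E)) x₀).contMDiffOn_section_baseSet_iff.1
    (X.contMDiff.contMDiffOn (s := (trivializationAt E (TangentSpace 𝓘(ℝ, E)) x₀).baseSet))
  have hmaps : Set.MapsTo (extChartAt 𝓘(ℝ, E) x₀).symm (extChartAt 𝓘(ℝ, E) x₀).target
      (trivializationAt E (TangentSpace 𝓘(ℝ, E)) x₀).baseSet := by
    simpa using (extChartAt 𝓘(ℝ, E) x₀).mapsTo_symm
  exact ((hX.comp (contMDiffOn_extChartAt_symm x₀) hmaps).contDiffOn).congr fun y hy =>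
    (trivializationAt_apply_snd_eq_chartField X x₀ hy).symm

theorem chartRep_self {q : ℕ} (α : RawForm E M q) (x : M) :
    chartRep α x (extChartAt 𝓘(ℝ, E) x x) = α x :=
  compContinuousLinearMap_congr α (extChartAt_to_inv x) (chartDiff_self x)

theorem rawExtDeriv_self {q : ℕ} (α : RawForm E M q) (x : M) :
    rawExtDeriv α x = extDeriv (chartRep α x) (extChartAt 𝓘(ℝ, E) x x) := by
  have comp_of_eq_id (f : E [⋀^Fin (q + 1)]→L[ℝ] ℝ) (L : E →L[ℝ] E) (hL : L = .id ℝ E) :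
      f.compContinuousLinearMap L = f := by
    rw [hL]
    rfl
  exact comp_of_eq_id _ _ mfderiv_extChartAt_self

theorem contDiffAt_chart_change (x₀ x₁ : M) {y : E}
    (hy : y ∈ (extChartAt 𝓘(ℝ, E) x₀).target)
    (hy' : (extChartAt 𝓘(ℝ, E) x₀).symm y ∈ (extChartAt 𝓘(ℝ, E) x₁).source) :
    ContDiffAt ℝ ∞ (extChartAt 𝓘(ℝ, E) x₁ ∘ (extChartAt 𝓘(ℝ, E) x₀).symm) y := by
  have hsymm : ContMDiffAt 𝓘(ℝ, E) 𝓘(ℝ, E) ∞ (extChartAt 𝓘(ℝ, E) x₀).symm y :=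
    (contMDiffOn_extChartAt_symm x₀).contMDiffAt ((isOpen_extChartAt_target x₀).mem_nhds hy)
  rw [extChartAt_source] at hy'
  exact ((contMDiffAt_extChartAt' hy').comp y hsymm).contDiffAt

theorem eventually_mem_chart_overlap (x₀ x₁ : M) {y : E}
    (hy : y ∈ (extChartAt 𝓘(ℝ, E) x₀).target)
    (hy' : (extChartAt 𝓘(ℝ, E) x₀).symm y ∈ (extChartAt 𝓘(ℝ, E) x₁).source) :
    ∀ᶠ z in 𝓝 y, z ∈ (extChartAt 𝓘(ℝ, E) x₀).target ∧
      (extChartAt 𝓘(ℝ, E) x₀).symm z ∈ (extChartAt 𝓘(ℝ, E) x₁).source :=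
  Filter.inter_mem ((isOpen_extChartAt_target x₀).mem_nhds hy)
    ((mdifferentiableAt_extChartAt_symm hy).continuousAt
      ((isOpen_extChartAt_source x₁).mem_nhds hy'))

theorem chartDiff_eq_comp (x₀ x₁ : M) {y : E}
    (hy : y ∈ (extChartAt 𝓘(ℝ, E) x₀).target)
    (hy' : (extChartAt 𝓘(ℝ, E) x₀).symm y ∈ (extChartAt 𝓘(ℝ, E) x₁).source) :
    chartDiff x₀ y = chartDiff x₁ (extChartAt 𝓘(ℝ, E) x₁ ((extChartAt 𝓘(ℝ, E) x₀).symm y)) ∘L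
      fderiv ℝ (extChartAt 𝓘(ℝ, E) x₁ ∘ (extChartAt 𝓘(ℝ, E) x₀).symm) y := by
  have hT : MDifferentiableAt 𝓘(ℝ, E) 𝓘(ℝ, E)
      (extChartAt 𝓘(ℝ, E) x₁ ∘ (extChartAt 𝓘(ℝ, E) x₀).symm) y :=
    ((contDiffAt_chart_change x₀ x₁ hy hy').differentiableAt (by simp)).mdifferentiableAt
  have hev : (extChartAt 𝓘(ℝ, E) x₀).symm =ᶠ[𝓝 y] (extChartAt 𝓘(ℝ, E) x₁).symm ∘
      (extChartAt 𝓘(ℝ, E) x₁ ∘ (extChartAt 𝓘(ℝ, E) x₀).symm) := by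
    filter_upwards [eventually_mem_chart_overlap x₀ x₁ hy hy'] with z hz
    exact ((extChartAt 𝓘(ℝ, E) x₁).left_inv hz.2).symm
  have mfderiv_factored := hev.mfderiv_eq (I := 𝓘(ℝ, E)) (I' := 𝓘(ℝ, E))
  have chain_rule := mfderiv_comp y (mdifferentiableAt_extChartAt_symm
    ((extChartAt 𝓘(ℝ, E) x₁).map_source hy')) hT
  rw [mfderiv_eq_fderiv] at chain_rule
  exact mfderiv_factored.trans chain_rule

theorem chartRep_eq_pullback {q : ℕ} (α : RawForm E M q) (x₀ x₁ : M) {y : E}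
    (hy : y ∈ (extChartAt 𝓘(ℝ, E) x₀).target)
    (hy' : (extChartAt 𝓘(ℝ, E) x₀).symm y ∈ (extChartAt 𝓘(ℝ, E) x₁).source) :
    chartRep α x₀ y =
      (chartRep α x₁ ((extChartAt 𝓘(ℝ, E) x₁ ∘ (extChartAt 𝓘(ℝ, E) x₀).symm) y)
        ).compContinuousLinearMap
        (fderiv ℝ (extChartAt 𝓘(ℝ, E) x₁ ∘ (extChartAt 𝓘(ℝ, E) x₀).symm) y) :=
  compContinuousLinearMap_congr α ((extChartAt 𝓘(ℝ, E) x₁).left_inv hy').symm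
    (chartDiff_eq_comp x₀ x₁ hy hy')

theorem chartRep_rawExtDeriv {q : ℕ} {α : RawForm E M q} (hα : IsSmoothForm α) (x₀ : M) {y : E}
    (hy : y ∈ (extChartAt 𝓘(ℝ, E) x₀).target) :
    chartRep (rawExtDeriv α) x₀ y = extDeriv (chartRep α x₀) y := by
  set x := (extChartAt 𝓘(ℝ, E) x₀).symm y
  have hy' : (extChartAt 𝓘(ℝ, E) x₀).symm y ∈ (extChartAt 𝓘(ℝ, E) x).source :=
    mem_extChartAt_source x
  have hev : chartRep α x₀ =ᶠ[𝓝 y] fun z =>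
      (chartRep α x ((extChartAt 𝓘(ℝ, E) x ∘ (extChartAt 𝓘(ℝ, E) x₀).symm) z)
        ).compContinuousLinearMap
        (fderiv ℝ (extChartAt 𝓘(ℝ, E) x ∘ (extChartAt 𝓘(ℝ, E) x₀).symm) z) := by
    filter_upwards [eventually_mem_chart_overlap x₀ x hy hy'] with z hz
    exact chartRep_eq_pullback α x₀ x hz.1 hz.2
  have hd : DifferentiableAt ℝ (chartRep α x)
      ((extChartAt 𝓘(ℝ, E) x ∘ (extChartAt 𝓘(ℝ, E) x₀).symm) y) := hα.differentiableAt x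
  rw [hev.extDeriv_eq, extDeriv_pullback hd (contDiffAt_chart_change x₀ x hy hy')
    (by rw [minSmoothness_of_isRCLikeNormedField]; exact WithTop.coe_le_coe.2 le_top),
    chartRep_eq_pullback (rawExtDeriv α) x₀ x hy hy']
  congr 1
  exact (chartRep_self (rawExtDeriv α) x).trans (rawExtDeriv_self α x)

theorem IsSmoothForm.rawExtDeriv {q : ℕ} {α : RawForm E M q} (hα : IsSmoothForm α) :
    IsSmoothForm (rawExtDeriv α) := fun x₀ =>
  (contDiffOn_extDeriv (isOpen_extChartAt_target x₀) (hα x₀) (by simp)).congr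
    fun _ hy => chartRep_rawExtDeriv hα x₀ hy

theorem rawExtDeriv_rawExtDeriv {q : ℕ} {α : RawForm E M q} (hα : IsSmoothForm α) :
    rawExtDeriv (rawExtDeriv α) = 0 := by
  funext x
  have hmem := (isOpen_extChartAt_target (I := 𝓘(ℝ, E)) x).mem_nhds (mem_extChartAt_target x)
  have h : chartRep (MultiSymp.rawExtDeriv α) x =ᶠ[𝓝 (extChartAt 𝓘(ℝ, E) x x)]
      extDeriv (chartRep α x) := by
    filter_upwards [hmem] with y hy using chartRep_rawExtDeriv hα x hy
  rw [MultiSymp.rawExtDeriv, h.extDeriv_eq, extDeriv_extDeriv_apply ((hα x).contDiffAt hmem)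
    (by rw [minSmoothness_of_isRCLikeNormedField]; exact WithTop.coe_le_coe.2 le_top)]
  rfl

end Charts

section PointwiseContraction

theorem exteriorPower_map_mem {R W N : Type*} [CommRing R] [AddCommGroup W] [Module R W]
    [AddCommGroup N] [Module R N] {m : ℕ} (f : ⋀[R]^m W →ₗ[R] N) {S : Submodule R N}
    (h : ∀ y, f (exteriorPower.ιMulti R m y) ∈ S) (Y : ⋀[R]^m W) : f Y ∈ S := by
  have hle : Submodule.span R (Set.range (exteriorPower.ιMulti R m)) ≤ S.comap f :=
    Submodule.span_le.2 (Set.range_subset_iff.2 h)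
  exact hle (by rw [exteriorPower.ιMulti_span]; trivial)

variable {V : Type*} [AddCommGroup V] [Module ℝ V] [TopologicalSpace V]

theorem apply_comp_finCast (β : (q : ℕ) → V [⋀^Fin q]→L[ℝ] ℝ) {a b : ℕ} (h : a = b)
    (u : Fin b → V) : β a (u ∘ Fin.cast h) = β b u := by
  subst h
  rfl

theorem contract_add_right {m q : ℕ} (Y : ⋀[ℝ]^m V) (α β : V [⋀^Fin (m + q)]→L[ℝ] ℝ) :
    contract Y (α + β) = contract Y α + contract Y β := by
  have h : contractAlt (α + β) = contractAlt α + contractAlt β := rfl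
  rw [contract, h, map_add]
  rfl

theorem contract_smul_right {m q : ℕ} (c : ℝ) (Y : ⋀[ℝ]^m V) (α : V [⋀^Fin (m + q)]→L[ℝ] ℝ) :
    contract Y (c • α) = c • contract Y α := by
  have h : contractAlt (c • α) = c • contractAlt α := rfl
  rw [contract, h, map_smul]
  rfl

/-- Contraction `Y ↦ ι_Y` as a linear map into the endomorphisms of the inhomogeneous alternating
forms, so that contractions can be composed without keeping track of degrees. -/
def contraction {m : ℕ} : ⋀[ℝ]^m V →ₗ[ℝ] Module.End ℝ ((q : ℕ) → V [⋀^Fin q]→L[ℝ] ℝ) :=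
  LinearMap.mk₂ ℝ (fun Y β q => contract Y (β (m + q)))
    (fun _ _ _ => funext fun _ => map_add _ _ _)
    (fun _ _ _ => funext fun _ => map_smul _ _ _)
    (fun _ _ _ => funext fun _ => contract_add_right _ _ _)
    (fun _ _ _ => funext fun _ => contract_smul_right _ _ _)

theorem contraction_ιMulti_apply {m : ℕ} (y : Fin m → V) (β : (q : ℕ) → V [⋀^Fin q]→L[ℝ] ℝ)
    (q : ℕ) (w : Fin q → V) :
    contraction (exteriorPower.ιMulti ℝ m y) β q w = β (m + q) (Fin.append y w) := by
  change contract _ _ _ = _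
  rw [contract, exteriorPower.alternatingMapLinearEquiv_apply_ιMulti]
  rfl

theorem contraction_singleton_apply (a : V) (β : (q : ℕ) → V [⋀^Fin q]→L[ℝ] ℝ) (q : ℕ)
    (w : Fin q → V) :
    contraction (exteriorPower.ιMulti ℝ 1 ![a]) β q w = β (q + 1) (Matrix.vecCons a w) := by
  rw [contraction_ιMulti_apply, Fin.append_left_eq_cons, apply_comp_finCast]
  rfl

theorem contraction_ιMulti_vecCons {m : ℕ} (a : V) (y : Fin m → V) :
    contraction (exteriorPower.ιMulti ℝ (m + 1) (Matrix.vecCons a y)) =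
      contraction (exteriorPower.ιMulti ℝ m y) * contraction (exteriorPower.ιMulti ℝ 1 ![a]) := by
  ext β q w
  rw [Module.End.mul_apply, contraction_ιMulti_apply, contraction_ιMulti_apply,
    contraction_singleton_apply, Matrix.vecCons, Fin.append_cons, apply_comp_finCast]
  rfl

theorem contraction_ιMulti_zero (y : Fin 0 → V) :
    contraction (exteriorPower.ιMulti ℝ 0 y) = 1 := by
  ext β q w
  rw [contraction_ιMulti_apply, Fin.append_left_nil _ _ rfl, apply_comp_finCast,
    Module.End.one_apply]

theorem contraction_singleton_anticomm (a b : V) :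
    contraction (exteriorPower.ιMulti ℝ 1 ![a]) * contraction (exteriorPower.ιMulti ℝ 1 ![b]) =
      (-1 : ℝ) • (contraction (exteriorPower.ιMulti ℝ 1 ![b]) *
        contraction (exteriorPower.ιMulti ℝ 1 ![a])) := by
  have hswap : ![a, b] ∘ Equiv.swap 0 1 = ![b, a] := by
    ext i
    fin_cases i <;> rfl
  rw [← contraction_ιMulti_vecCons, ← contraction_ιMulti_vecCons, ← map_smul contraction, ← hswap,
    (exteriorPower.ιMulti ℝ (1 + 1)).map_swap _ zero_ne_one, neg_one_smul]

theorem contraction_singleton_mul_ιMulti {m : ℕ} (a : V) (y : Fin m → V) :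
    contraction (exteriorPower.ιMulti ℝ 1 ![a]) * contraction (exteriorPower.ιMulti ℝ m y) =
      (-1 : ℝ) ^ m • (contraction (exteriorPower.ιMulti ℝ m y) *
        contraction (exteriorPower.ιMulti ℝ 1 ![a])) := by
  induction m with
  | zero => simp [contraction_ιMulti_zero]
  | succ m ih =>
    obtain ⟨b, y, rfl⟩ : ∃ b z, y = Matrix.vecCons b z := Fin.exists_cons y
    rw [contraction_ιMulti_vecCons b y, ← mul_assoc, ih, smul_mul_assoc, mul_assoc,
      contraction_singleton_anticomm a b, mul_smul_comm, mul_assoc, smul_smul, pow_succ]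

theorem contraction_singleton_mul {m : ℕ} (a : V) (Y : ⋀[ℝ]^m V) :
    contraction (exteriorPower.ιMulti ℝ 1 ![a]) * contraction Y =
      (-1 : ℝ) ^ m • (contraction Y * contraction (exteriorPower.ιMulti ℝ 1 ![a])) := by
  set c := contraction (exteriorPower.ιMulti ℝ 1 ![a])
  have h : LinearMap.mulLeft ℝ c ∘ₗ contraction =
      (-1 : ℝ) ^ m • (LinearMap.mulRight ℝ c ∘ₗ contraction) :=
    exteriorPower.linearMap_ext (N := Module.End ℝ ((q : ℕ) → V [⋀^Fin q]→L[ℝ] ℝ)) (by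
      ext y : 1
      exact contraction_singleton_mul_ιMulti a y)
  exact LinearMap.congr_fun h Y

end PointwiseContraction

section FormCalculus

variable {E : Type*} [NormedAddCommGroup E] [NormedSpace ℝ E]
  {M : Type*} [TopologicalSpace M] [ChartedSpace E M]

theorem iota_add {m : ℕ} (Y : MultivectorField E M m) (α β : TotalForm E M) :
    iota Y (α + β) = iota Y α + iota Y β :=
  funext fun _ => funext fun _ => contract_add_right _ _ _

theorem iota_smul {m : ℕ} (c : ℝ) (Y : MultivectorField E M m) (α : TotalForm E M) :
    iota Y (c • α) = c • iota Y α :=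
  funext fun _ => funext fun _ => contract_smul_right _ _ _

theorem iota_sub {m : ℕ} (Y : MultivectorField E M m) (α β : TotalForm E M) :
    iota Y (α - β) = iota Y α - iota Y β := by
  rw [show α - β = α + (-1 : ℝ) • β by module, iota_add, iota_smul]
  module

theorem iota_zero {m : ℕ} (Y : MultivectorField E M m) : iota Y (0 : TotalForm E M) = 0 := by
  simpa using iota_smul 0 Y (0 : TotalForm E M)

theorem iota_apply_eq_zero {m : ℕ} (Y : MultivectorField E M m) {α : TotalForm E M} {q : ℕ}
    (h : α (m + q) = 0) : iota Y α q = 0 := by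
  have hα : iota Y α q = iota Y 0 q := by
    unfold iota
    rw [h]
    rfl
  rw [hα, iota_zero, Pi.zero_apply]

theorem iota_toMultivector_apply (X : (x : M) → TangentSpace 𝓘(ℝ, E) x) (α : TotalForm E M)
    (q : ℕ) (x : M) (w : Fin q → TangentSpace 𝓘(ℝ, E) x) :
    iota (toMultivector X) α q x w = α (q + 1) x (Matrix.vecCons (X x) w) :=
  contraction_singleton_apply (X x) (fun q => α q x) q w

theorem iota_toMultivector_comm {m : ℕ} (X : (x : M) → TangentSpace 𝓘(ℝ, E) x)
    (Y : MultivectorField E M m) (α : TotalForm E M) :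
    iota (toMultivector X) (iota Y α) = (-1 : ℝ) ^ m • iota Y (iota (toMultivector X) α) := by
  funext q x
  exact congrFun (LinearMap.congr_fun (contraction_singleton_mul (X x) (Y x)) fun q => α q x) q

theorem lieDer_toMultivector (X : (x : M) → TangentSpace 𝓘(ℝ, E) x) (α : TotalForm E M) :
    lieDer (toMultivector X) α =
      dForm (iota (toMultivector X) α) + iota (toMultivector X) (dForm α) := by
  rw [lieDer]
  module

variable (E M) in
/-- The smooth inhomogeneous differential forms. -/
def smoothForms : Submodule ℝ (TotalForm E M) where
  carrier := {α | ∀ q, IsSmoothForm (α q)}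
  add_mem' hα hβ q x₀ := (hα q x₀).add (hβ q x₀)
  zero_mem' _ _ := contDiffOn_const (c := 0)
  smul_mem' c _ hα q x₀ := (hα q x₀).const_smul c

theorem rawExtDeriv_zero (q : ℕ) : rawExtDeriv (0 : RawForm E M q) = 0 := by
  simpa using rawExtDeriv_smul 0 (0 : RawForm E M q)

theorem lieDer_zero {m : ℕ} (Y : MultivectorField E M m) : lieDer Y (0 : TotalForm E M) = 0 := by
  rw [lieDer, iota_zero, dForm_zero, iota_zero, smul_zero, sub_zero]

variable [IsManifold 𝓘(ℝ, E) ∞ M]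

theorem dForm_mem_smoothForms {α : TotalForm E M} (hα : α ∈ smoothForms E M) :
    dForm α ∈ smoothForms E M
  | 0 => (smoothForms E M).zero_mem 0
  | q + 1 => (hα q).rawExtDeriv

theorem dForm_mem_Omega {i j : ℤ} {α : TotalForm E M} (hα : α ∈ Omega E M i) (hij : i + 1 = j) :
    dForm α ∈ Omega E M j := by
  refine ⟨dForm_mem_smoothForms hα.1, fun q hq => ?_⟩
  cases q with
  | zero => rfl
  | succ q =>
    have hαq : α q = 0 := hα.2 q (by push_cast at hq; omega)
    rw [dForm, hαq, rawExtDeriv_zero]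

theorem dForm_dForm {α : TotalForm E M} (hα : α ∈ smoothForms E M) : dForm (dForm α) = 0 := by
  funext q
  match q with
  | 0 => rfl
  | 1 => exact rawExtDeriv_zero 0
  | q + 2 => exact rawExtDeriv_rawExtDeriv (hα q)

theorem exactForms_le_closedForms (j : ℤ) : exactForms E M j ≤ closedForms E M j := by
  rintro _ ⟨β, hβ, rfl⟩
  exact ⟨dForm_mem_Omega hβ (sub_add_cancel j 1), dForm_dForm hβ.1⟩

theorem lieDer_dForm {m : ℕ} (Y : MultivectorField E M m) {α : TotalForm E M}
    (hα : α ∈ smoothForms E M) : lieDer Y (dForm α) = dForm (iota Y (dForm α)) := by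
  rw [lieDer, dForm_dForm hα, iota_zero, smul_zero, sub_zero]

theorem dForm_lieDer {m : ℕ} (Y : MultivectorField E M m) {α : TotalForm E M}
    (hα : α ∈ smoothForms E M) (hY : iota Y α ∈ smoothForms E M)
    (hdY : iota Y (dForm α) ∈ smoothForms E M) :
    dForm (lieDer Y α) = -(-1 : ℝ) ^ m • lieDer Y (dForm α) := by
  rw [lieDer_dForm Y hα, lieDer, sub_eq_add_neg,
    show -((-1 : ℝ) ^ m • iota Y (dForm α)) = -(-1 : ℝ) ^ m • iota Y (dForm α) by module,
    dForm_add (dForm_mem_smoothForms hY) (Submodule.smul_mem (smoothForms E M) _ hdY),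
    dForm_dForm hY, dForm_smul, zero_add]

theorem chartRep_iota_toMultivector (X : (x : M) → TangentSpace 𝓘(ℝ, E) x) (α : TotalForm E M)
    (q : ℕ) (x₀ : M) {y : E} (hy : y ∈ (extChartAt 𝓘(ℝ, E) x₀).target) :
    chartRep (iota (toMultivector X) α q) x₀ y =
      (chartRep (α (q + 1)) x₀ y).curryLeft (chartField X x₀ y) := by
  ext w
  refine (iota_toMultivector_apply X α q _ _).trans ?_
  change α (q + 1) ((extChartAt 𝓘(ℝ, E) x₀).symm y) _ =
    α (q + 1) ((extChartAt 𝓘(ℝ, E) x₀).symm y)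
      (chartDiff x₀ y ∘ Matrix.vecCons (chartField X x₀ y) w)
  congr 1
  funext i
  refine Fin.cases ?_ (fun i => rfl) i
  exact (chartDiff_chartField X x₀ hy).symm

theorem chartRep_iota_toMultivector_eventuallyEq (X : (x : M) → TangentSpace 𝓘(ℝ, E) x)
    (α : TotalForm E M) (q : ℕ) (x : M) :
    chartRep (iota (toMultivector X) α q) x =ᶠ[𝓝 (extChartAt 𝓘(ℝ, E) x x)]
      fun y => (chartRep (α (q + 1)) x y).curryLeft (chartField X x y) := by
  filter_upwards [(isOpen_extChartAt_target x).mem_nhds (mem_extChartAt_target x)] with y hy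
  exact chartRep_iota_toMultivector X α q x hy

theorem iota_toMultivector_mem_smoothForms (X : VectorFields E M) {α : TotalForm E M}
    (hα : α ∈ smoothForms E M) : iota (toMultivector X) α ∈ smoothForms E M := by
  refine fun q x₀ => ContDiffOn.congr ?_ fun y hy => chartRep_iota_toMultivector X α q x₀ hy
  exact ((curryLeftCLM ℝ E ℝ q).contDiff.comp_contDiffOn (hα (q + 1) x₀)).clm_apply
    (contDiffOn_chartField X x₀)

theorem iota_toMultivector_mem_Omega (X : VectorFields E M) {i j : ℤ} {α : TotalForm E M}
    (hα : α ∈ Omega E M i) (hij : j + 1 = i) : iota (toMultivector X) α ∈ Omega E M j :=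
  ⟨iota_toMultivector_mem_smoothForms X hα.1, fun _ hq =>
    iota_apply_eq_zero _ (hα.2 _ (by push_cast; omega))⟩

theorem differentiableAt_chartField (X : VectorFields E M) (x : M) :
    DifferentiableAt ℝ (chartField X x) (extChartAt 𝓘(ℝ, E) x x) :=
  ((contDiffOn_chartField X x).contDiffAt
    ((isOpen_extChartAt_target x).mem_nhds (mem_extChartAt_target x))).differentiableAt (by simp)

theorem lieDer_toMultivector_apply (X : VectorFields E M) {α : TotalForm E M}
    (hα : α ∈ smoothForms E M) (q : ℕ) (x : M) (w : Fin q → TangentSpace 𝓘(ℝ, E) x) :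
    lieDer (toMultivector X) α q x w =
      localLieDer (chartField X x) (chartRep (α q) x) (extChartAt 𝓘(ℝ, E) x x) w := by
  have contracted_differential : iota (toMultivector X) (dForm α) q x w =
      extDeriv (chartRep (α q) x) (extChartAt 𝓘(ℝ, E) x x)
        (Matrix.vecCons (chartField X x (extChartAt 𝓘(ℝ, E) x x)) w) := by
    rw [iota_toMultivector_apply, dForm, rawExtDeriv_self, chartField_self]
    rfl
  rw [lieDer_toMultivector]
  refine (congrArg (dForm (iota (toMultivector X) α) q x w + ·) contracted_differential).trans ?_
  cases q with
  | zero => exact (zero_add _).trans (extDeriv_vecCons_eq_localLieDer _ _ _)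
  | succ q =>
    rw [dForm, rawExtDeriv_self,
      (chartRep_iota_toMultivector_eventuallyEq X α q x).extDeriv_eq]
    exact extDeriv_curryLeft_add_extDeriv_vecCons ((hα (q + 1)).differentiableAt x)
      (differentiableAt_chartField X x) w

theorem lieDer_iota (X Y : VectorFields E M) {α : TotalForm E M} (hα : α ∈ smoothForms E M) :
    lieDer (toMultivector X) (iota (toMultivector Y) α) =
      iota (toMultivector Y) (lieDer (toMultivector X) α) +
        iota (toMultivector (VectorField.mlieBracket 𝓘(ℝ, E) X Y)) α := by
  funext q x
  ext w
  have hYα := (localLieDer_congr (chartRep_iota_toMultivector_eventuallyEq Y α q x)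
    (chartField X x) w).trans (localLieDer_curryLeft ((hα (q + 1)).differentiableAt x)
      (differentiableAt_chartField Y x) w)
  have contracted_lieDer : iota (toMultivector Y) (lieDer (toMultivector X) α) q x w =
      localLieDer (chartField X x) (chartRep (α (q + 1)) x) (extChartAt 𝓘(ℝ, E) x x)
        (Matrix.vecCons (chartField Y x (extChartAt 𝓘(ℝ, E) x x)) w) := by
    rw [iota_toMultivector_apply, lieDer_toMultivector_apply X hα, chartField_self]
    rfl
  have contracted_bracket :
      iota (toMultivector (VectorField.mlieBracket 𝓘(ℝ, E) X Y)) α q x w =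
        chartRep (α (q + 1)) x (extChartAt 𝓘(ℝ, E) x x) (Matrix.vecCons (VectorField.lieBracket ℝ
          (chartField X x) (chartField Y x) (extChartAt 𝓘(ℝ, E) x x)) w) := by
    rw [iota_toMultivector_apply, mlieBracket_eq_lieBracket_chartField, chartRep_self]
    rfl
  exact ((lieDer_toMultivector_apply X (iota_toMultivector_mem_smoothForms Y hα) q x w).trans
    hYα).trans (congrArg₂ (· + ·) contracted_lieDer contracted_bracket).symm

end FormCalculus

section Boundary

variable (𝔤 : Type*) [LieRing 𝔤] [LieAlgebra ℝ 𝔤]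

theorem boundary_ιMulti (k : ℕ) (x : Fin (k + 2) → 𝔤) :
    boundary 𝔤 (k + 1) (exteriorPower.ιMulti ℝ (k + 2) x) =
      -∑ i : Fin (k + 1), ∑ j ≥ i, (-1 : ℝ) ^ (i + j : ℕ) •
        exteriorPower.ιMulti ℝ (k + 1)
          (Matrix.vecCons ⁅x i.castSucc, x j.succ⁆ (j.removeNth (i.castSucc.removeNth x))) := by
  rw [boundary, exteriorPower.alternatingMapLinearEquiv_apply_ιMulti, boundaryAlt_apply]

theorem sum_Ici_succ {N : Type*} [AddCommMonoid N] {k : ℕ} (i : Fin k) (g : Fin (k + 1) → N) :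
    ∑ j ≥ i.succ, g j = ∑ j ≥ i, g j.succ := by
  rw [← Fin.map_succEmb_Ici, Finset.sum_map]
  rfl

variable {𝔤}

/-- Exterior multiplication `p ↦ b ∧ p`. -/
def wedgeLeft {k : ℕ} (b : 𝔤) : ⋀[ℝ]^k 𝔤 →ₗ[ℝ] ⋀[ℝ]^(k + 1) 𝔤 :=
  exteriorPower.alternatingMapLinearEquiv ((exteriorPower.ιMulti ℝ (k + 1)).curryLeft b)

theorem wedgeLeft_ιMulti {k : ℕ} (b : 𝔤) (a : Fin k → 𝔤) :
    wedgeLeft b (exteriorPower.ιMulti ℝ k a) =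
      exteriorPower.ιMulti ℝ (k + 1) (Matrix.vecCons b a) := by
  rw [wedgeLeft, exteriorPower.alternatingMapLinearEquiv_apply_ιMulti,
    AlternatingMap.curryLeft_apply_apply]

theorem ιMulti_vecCons_vecCons_swap {k : ℕ} (b c : 𝔤) (a : Fin k → 𝔤) :
    exteriorPower.ιMulti ℝ (k + 2) (Matrix.vecCons c (Matrix.vecCons b a)) =
      -exteriorPower.ιMulti ℝ (k + 2) (Matrix.vecCons b (Matrix.vecCons c a)) := by
  have hswap : Matrix.vecCons b (Matrix.vecCons c a) ∘ Equiv.swap 0 1 =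
      Matrix.vecCons c (Matrix.vecCons b a) := by
    funext i
    refine Fin.cases rfl (fun i => Fin.cases rfl (fun i => ?_) i) i
    rw [Function.comp_apply, Equiv.swap_apply_of_ne_of_ne (Fin.succ_ne_zero _)
      (Fin.succ_succ_ne_one i)]
    rfl
  rw [← hswap, AlternatingMap.map_swap _ _ zero_ne_one]

theorem boundary_vecCons {k : ℕ} (b : 𝔤) (a : Fin (k + 1) → 𝔤) :
    boundary 𝔤 (k + 1) (exteriorPower.ιMulti ℝ (k + 2) (Matrix.vecCons b a)) =
      -(∑ i, exteriorPower.ιMulti ℝ (k + 1) (Function.update a i ⁅b, a i⁆)) -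
        wedgeLeft b (boundary 𝔤 k (exteriorPower.ιMulti ℝ (k + 1) a)) := by
  have pairs_with_b : ∑ j ≥ (0 : Fin (k + 1)), (-1 : ℝ) ^ ((0 : Fin (k + 1)) + j : ℕ) •
      exteriorPower.ιMulti ℝ (k + 1) (Matrix.vecCons
        ⁅Matrix.vecCons b a (0 : Fin (k + 1)).castSucc, Matrix.vecCons b a j.succ⁆
        (j.removeNth ((0 : Fin (k + 1)).castSucc.removeNth (Matrix.vecCons b a)))) =
      ∑ j, exteriorPower.ιMulti ℝ (k + 1) (Function.update a j ⁅b, a j⁆) := by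
    refine Finset.sum_congr (by ext; simp) fun j _ => ?_
    rw [← neg_one_pow_smul_map_vecCons_removeNth, ← Int.cast_smul_eq_zsmul ℝ]
    simp [Fin.tail_def]
  rw [boundary_ιMulti, Fin.sum_univ_succ, pairs_with_b, neg_add, ← sub_eq_add_neg]
  congr 1
  cases k with
  | zero => simp [boundary]
  | succ k =>
    rw [boundary_ιMulti, map_neg, map_sum, ← Finset.sum_neg_distrib]
    refine Finset.sum_congr rfl fun i _ => ?_
    rw [map_sum, sum_Ici_succ, ← Finset.sum_neg_distrib]
    refine Finset.sum_congr rfl fun j _ => ?_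
    rw [← Fin.succ_castSucc, removeNth_succ_vecCons, removeNth_succ_vecCons,
      ιMulti_vecCons_vecCons_swap, smul_neg, map_smul, wedgeLeft_ιMulti]
    simp only [Matrix.cons_val_succ, Fin.val_succ]
    rw [show (i + 1 + (j + 1) : ℕ) = i + j + 2 by ring, pow_add, neg_one_sq, mul_one]

end Boundary

section Action

variable {E : Type*} [NormedAddCommGroup E] [NormedSpace ℝ E]
  {M : Type*} [TopologicalSpace M] [ChartedSpace E M] [IsManifold 𝓘(ℝ, E) ∞ M]
  {𝔤 : Type*} [LieRing 𝔤] [LieAlgebra ℝ 𝔤]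

namespace InfinitesimalAction

variable (v : InfinitesimalAction E M 𝔤)

/-- The bilinear map `(p, α) ↦ ι(v_p) α`. -/
def iotaMulti {k : ℕ} : ⋀[ℝ]^k 𝔤 →ₗ[ℝ] TotalForm E M →ₗ[ℝ] TotalForm E M :=
  LinearMap.mk₂ ℝ (fun p α => iota (v.multi p) α)
    (fun p p' α => funext fun q => funext fun x =>
      congrFun (LinearMap.congr_fun (map_add (contraction ∘ₗ exteriorPower.map k (v.at' x)) p p')
        fun q => α q x) q)
    (fun c p α => funext fun q => funext fun x =>
      congrFun (LinearMap.congr_fun (map_smul (contraction ∘ₗ exteriorPower.map k (v.at' x)) c p)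
        fun q => α q x) q)
    (fun p => iota_add (v.multi p))
    (fun c p => iota_smul c (v.multi p))

theorem iotaMulti_apply {k : ℕ} (p : ⋀[ℝ]^k 𝔤) (α : TotalForm E M) :
    v.iotaMulti p α = iota (v.multi p) α := rfl

theorem iotaMulti_ιMulti_apply {k : ℕ} (a : Fin k → 𝔤) (α : TotalForm E M) (q : ℕ) (x : M) :
    v.iotaMulti (exteriorPower.ιMulti ℝ k a) α q x =
      contraction (exteriorPower.ιMulti ℝ k fun i => v.field (a i) x) (fun q => α q x) q := by
  change contract (exteriorPower.map k (v.at' x) _) _ = _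
  rw [exteriorPower.map_apply_ιMulti]
  rfl

theorem iotaMulti_ιMulti_zero (a : Fin 0 → 𝔤) (α : TotalForm E M) :
    v.iotaMulti (exteriorPower.ιMulti ℝ 0 a) α = α := by
  funext q x
  rw [iotaMulti_ιMulti_apply, contraction_ιMulti_zero, Module.End.one_apply]

theorem iotaMulti_vecCons {k : ℕ} (b : 𝔤) (a : Fin k → 𝔤) (α : TotalForm E M) :
    v.iotaMulti (exteriorPower.ιMulti ℝ (k + 1) (Matrix.vecCons b a)) α =
      v.iotaMulti (exteriorPower.ιMulti ℝ k a) (iota (toMultivector (v.field b)) α) := by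
  funext q x
  have hfields : (fun i => v.field (Matrix.vecCons b a i) x) =
      Matrix.vecCons (v.field b x) fun i => v.field (a i) x := by
    funext i
    refine Fin.cases rfl (fun _ => rfl) i
  rw [iotaMulti_ιMulti_apply, iotaMulti_ιMulti_apply, hfields, contraction_ιMulti_vecCons]
  rfl

theorem iotaMulti_wedgeLeft {k : ℕ} (b : 𝔤) (p : ⋀[ℝ]^k 𝔤) (α : TotalForm E M) :
    v.iotaMulti (wedgeLeft b p) α = v.iotaMulti p (iota (toMultivector (v.field b)) α) := by
  have h : v.iotaMulti.flip α ∘ₗ wedgeLeft (k := k) b =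
      v.iotaMulti.flip (iota (toMultivector (v.field b)) α) := exteriorPower.linearMap_ext <| by
    ext a : 1
    simpa [wedgeLeft_ιMulti] using v.iotaMulti_vecCons b a α
  exact LinearMap.congr_fun h p

theorem iotaMulti_mem_smoothForms {k : ℕ} (p : ⋀[ℝ]^k 𝔤) {α : TotalForm E M}
    (hα : α ∈ smoothForms E M) : v.iotaMulti p α ∈ smoothForms E M := by
  refine exteriorPower_map_mem (v.iotaMulti.flip α) (fun a => ?_) p
  rw [LinearMap.flip_apply]
  clear p
  induction k generalizing α with
  | zero => rwa [iotaMulti_ιMulti_zero]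
  | succ k ih =>
    obtain ⟨b, a, rfl⟩ : ∃ b z, a = Matrix.vecCons b z := Fin.exists_cons a
    rw [iotaMulti_vecCons]
    exact ih (iota_toMultivector_mem_smoothForms (v.field b) hα) a

theorem iotaMulti_mem_Omega {k : ℕ} (p : ⋀[ℝ]^k 𝔤) {i j : ℤ} {α : TotalForm E M}
    (hα : α ∈ Omega E M i) (hij : j + k = i) : v.iotaMulti p α ∈ Omega E M j :=
  ⟨v.iotaMulti_mem_smoothForms p hα.1, fun _ hq =>
    iota_apply_eq_zero _ (hα.2 _ (by push_cast; omega))⟩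

theorem lieDer_multi_mem_Omega {k : ℕ} (p : ⋀[ℝ]^k 𝔤) {i j : ℤ} {α : TotalForm E M}
    (hα : α ∈ Omega E M i) (hij : j + k = i + 1) : lieDer (v.multi p) α ∈ Omega E M j :=
  sub_mem (dForm_mem_Omega (v.iotaMulti_mem_Omega p hα (j := j - 1) (by omega)) (by omega))
    (Submodule.smul_mem _ _ (v.iotaMulti_mem_Omega p (dForm_mem_Omega hα rfl) hij))

theorem dForm_lieDer_multi {k : ℕ} (p : ⋀[ℝ]^k 𝔤) {α : TotalForm E M}
    (hα : α ∈ smoothForms E M) :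
    dForm (lieDer (v.multi p) α) = -(-1 : ℝ) ^ k • lieDer (v.multi p) (dForm α) :=
  dForm_lieDer _ hα (v.iotaMulti_mem_smoothForms p hα)
    (v.iotaMulti_mem_smoothForms p (dForm_mem_smoothForms hα))

/-- The map `p ↦ 𝓛_{v_p} α`, for a smooth form `α`; smoothness makes it additive. -/
def lieDerMulti {α : TotalForm E M} (hα : α ∈ smoothForms E M) (k : ℕ) :
    ⋀[ℝ]^k 𝔤 →ₗ[ℝ] TotalForm E M where
  toFun p := lieDer (v.multi p) α
  map_add' p p' := by
    simp only [lieDer, ← iotaMulti_apply, map_add, LinearMap.add_apply]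
    rw [dForm_add (v.iotaMulti_mem_smoothForms p hα) (v.iotaMulti_mem_smoothForms p' hα)]
    module
  map_smul' c p := by
    simp only [lieDer, ← iotaMulti_apply, map_smul, LinearMap.smul_apply, dForm_smul,
      RingHom.id_apply]
    module

theorem lieDer_multi_zero (p : ⋀[ℝ]^0 𝔤) {α : TotalForm E M} (hα : α ∈ smoothForms E M) :
    lieDer (v.multi p) α = 0 := by
  have h : v.lieDerMulti hα 0 = 0 := exteriorPower.linearMap_ext <| by
    ext a : 1
    change lieDer (v.multi (exteriorPower.ιMulti ℝ 0 a)) α = 0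
    rw [lieDer, ← iotaMulti_apply, ← iotaMulti_apply, iotaMulti_ιMulti_zero,
      iotaMulti_ιMulti_zero, pow_zero, one_smul, sub_self]
  exact LinearMap.congr_fun h p

theorem lieDer_multi_vecCons {k : ℕ} (b : 𝔤) (a : Fin k → 𝔤) (α : TotalForm E M) :
    lieDer (v.multi (exteriorPower.ιMulti ℝ (k + 1) (Matrix.vecCons b a))) α =
      (-1 : ℝ) ^ k •
        (lieDer (toMultivector (v.field b)) (v.iotaMulti (exteriorPower.ιMulti ℝ k a) α) -
          iota (toMultivector (v.field b))
            (lieDer (v.multi (exteriorPower.ιMulti ℝ k a)) α)) := by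
  rw [lieDer_toMultivector, lieDer, lieDer, ← iotaMulti_apply, ← iotaMulti_apply,
    ← iotaMulti_apply, ← iotaMulti_apply, iotaMulti_vecCons, iotaMulti_vecCons, iota_sub, iota_smul,
    iotaMulti_apply, iotaMulti_apply, iotaMulti_apply _ _ α, iotaMulti_apply _ _ (dForm α),
    iota_toMultivector_comm, iota_toMultivector_comm, dForm_smul]
  rcases neg_one_pow_eq_or ℝ k with hk | hk <;> rw [pow_succ, hk] <;> module

theorem lieDer_iota_field (b c : 𝔤) {α : TotalForm E M} (hα : α ∈ smoothForms E M) :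
    lieDer (toMultivector (v.field b)) (iota (toMultivector (v.field c)) α) =
      iota (toMultivector (v.field c)) (lieDer (toMultivector (v.field b)) α) +
        iota (toMultivector (v.field ⁅b, c⁆)) α := by
  have h : (⇑(v.field ⁅b, c⁆) : (x : M) → TangentSpace 𝓘(ℝ, E) x) =
      VectorField.mlieBracket 𝓘(ℝ, E) (v.field b) (v.field c) := funext (v.map_lie b c)
  rw [lieDer_iota _ _ hα, h]

theorem lieDer_iotaMulti {k : ℕ} (b : 𝔤) (a : Fin k → 𝔤) {α : TotalForm E M}
    (hα : α ∈ smoothForms E M) :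
    lieDer (toMultivector (v.field b)) (v.iotaMulti (exteriorPower.ιMulti ℝ k a) α) =
      v.iotaMulti (exteriorPower.ιMulti ℝ k a) (lieDer (toMultivector (v.field b)) α) +
        ∑ i, v.iotaMulti (exteriorPower.ιMulti ℝ k (Function.update a i ⁅b, a i⁆)) α := by
  induction k generalizing α with
  | zero => simp [iotaMulti_ιMulti_zero]
  | succ k ih =>
    obtain ⟨c, a, rfl⟩ : ∃ c z, a = Matrix.vecCons c z := Fin.exists_cons a
    have update_head : Function.update (Matrix.vecCons c a) 0 ⁅b, c⁆ = Matrix.vecCons ⁅b, c⁆ a :=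
      Fin.update_cons_zero _ _ _
    have update_tail (i : Fin k) : Function.update (Matrix.vecCons c a) i.succ ⁅b, a i⁆ =
        Matrix.vecCons c (Function.update a i ⁅b, a i⁆) := (Fin.cons_update _ _ _ _).symm
    rw [iotaMulti_vecCons, ih a (iota_toMultivector_mem_smoothForms (v.field c) hα),
      lieDer_iota_field v b c hα, map_add, Fin.sum_univ_succ]
    simp only [Matrix.cons_val_zero, Matrix.cons_val_succ, update_head, update_tail,
      iotaMulti_vecCons]
    rw [add_assoc]

theorem lieDer_multi_ιMulti_of_invariant {α : TotalForm E M} (hα : α ∈ smoothForms E M)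
    (hinv : ∀ b, lieDer (toMultivector (v.field b)) α = 0) {k : ℕ} (a : Fin (k + 1) → 𝔤) :
    lieDer (v.multi (exteriorPower.ιMulti ℝ (k + 1) a)) α =
      (-1 : ℝ) ^ (k + 1) •
        v.iotaMulti (boundary 𝔤 k (exteriorPower.ιMulti ℝ (k + 1) a)) α := by
  induction k with
  | zero =>
    obtain ⟨b, a, rfl⟩ : ∃ b z, a = Matrix.vecCons b z := Fin.exists_cons a
    rw [lieDer_multi_vecCons, iotaMulti_ιMulti_zero, hinv, lieDer_multi_zero v _ hα, iota_zero]
    simp [boundary]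
  | succ k ih =>
    obtain ⟨b, a, rfl⟩ : ∃ b z, a = Matrix.vecCons b z := Fin.exists_cons a
    have lieDer_contracted := v.lieDer_iotaMulti b a hα
    rw [hinv, map_zero, zero_add] at lieDer_contracted
    rw [lieDer_multi_vecCons, lieDer_contracted, ih a, iota_smul, iotaMulti_apply,
      iota_toMultivector_comm, ← iotaMulti_apply, ← iotaMulti_wedgeLeft, boundary_vecCons]
    simp only [map_sub, map_neg, map_sum, LinearMap.sub_apply, LinearMap.neg_apply,
      LinearMap.sum_apply]
    rcases neg_one_pow_eq_or ℝ k with hk | hk <;> simp only [pow_succ, hk] <;> module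

theorem lieDer_multi_of_invariant {α : TotalForm E M} (hα : α ∈ smoothForms E M)
    (hinv : ∀ b, lieDer (toMultivector (v.field b)) α = 0) {k : ℕ} (p : ⋀[ℝ]^(k + 1) 𝔤) :
    lieDer (v.multi p) α = (-1 : ℝ) ^ (k + 1) • v.iotaMulti (boundary 𝔤 k p) α := by
  have h : v.lieDerMulti hα (k + 1) =
      (-1 : ℝ) ^ (k + 1) • (v.iotaMulti.flip α ∘ₗ boundary 𝔤 k) := exteriorPower.linearMap_ext <| by
    ext a : 1
    exact v.lieDer_multi_ιMulti_of_invariant hα hinv a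
  exact LinearMap.congr_fun h p

end InfinitesimalAction

end Action

section Momenta

variable {E : Type*} [NormedAddCommGroup E] [NormedSpace ℝ E]
  {M : Type*} [TopologicalSpace M] [ChartedSpace E M]

theorem eq_zero_of_mem_Omega_of_neg {j : ℤ} (hj : j < 0) {α : TotalForm E M}
    (hα : α ∈ Omega E M j) : α = 0 :=
  funext fun q => hα.2 q (by omega)

theorem sgn_mul_self (k : ℕ) : sgn k * sgn k = 1 := by
  rw [sgn, neg_mul_neg, ← mul_pow, neg_one_mul, neg_neg, one_pow]

variable [IsManifold 𝓘(ℝ, E) ∞ M] {𝔤 : Type*} [LieRing 𝔤] [LieAlgebra ℝ 𝔤]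
  {v : InfinitesimalAction E M 𝔤} {H : TotalForm E M}

namespace InfinitesimalAction

theorem IsLocallyPreserving.lieDer_dForm_eq_zero (hloc : v.IsLocallyPreserving H)
    (hH : H ∈ smoothForms E M) (b : 𝔤) : lieDer (toMultivector (v.field b)) (dForm H) = 0 := by
  have h := dForm_lieDer (toMultivector (v.field b)) hH
    (iota_toMultivector_mem_smoothForms (v.field b) hH)
    (iota_toMultivector_mem_smoothForms (v.field b) (dForm_mem_smoothForms hH))
  rw [hloc b, pow_one, neg_neg, one_smul] at h
  exact h.symm

theorem IsLocallyPreserving.lieDer_multi_dForm (hloc : v.IsLocallyPreserving H)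
    (hH : H ∈ smoothForms E M) {k : ℕ} (p : ⋀[ℝ]^(k + 1) 𝔤) :
    lieDer (v.multi p) (dForm H) =
      (-1 : ℝ) ^ (k + 1) • v.iotaMulti (boundary 𝔤 k p) (dForm H) :=
  v.lieDer_multi_of_invariant (dForm_mem_smoothForms hH) (hloc.lieDer_dForm_eq_zero hH) p

theorem IsLocallyPreserving.dForm_lieDer_multi_of_mem_cycles (hloc : v.IsLocallyPreserving H)
    (hH : H ∈ smoothForms E M) {k : ℕ} {p : ⋀[ℝ]^k 𝔤} (hp : p ∈ cycles 𝔤 k) :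
    dForm (lieDer (v.multi p) H) = 0 := by
  cases k with
  | zero => rw [v.dForm_lieDer_multi p hH, v.lieDer_multi_zero p (dForm_mem_smoothForms hH),
      smul_zero]
  | succ k =>
    have boundary_eq_zero : boundary 𝔤 k p = 0 := hp
    rw [v.dForm_lieDer_multi p hH, hloc.lieDer_multi_dForm hH, boundary_eq_zero, map_zero,
      LinearMap.zero_apply, smul_zero, smul_zero]

theorem IsLocallyPreserving.lieDer_multi_boundary (hloc : v.IsLocallyPreserving H)
    (hH : H ∈ smoothForms E M) {k : ℕ} (p : ⋀[ℝ]^(k + 1) 𝔤) :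
    lieDer (v.multi (boundary 𝔤 k p)) H =
      dForm (v.iotaMulti (boundary 𝔤 k p) H + v.iotaMulti p (dForm H)) := by
  have hpH := hloc.lieDer_multi_dForm hH p
  rw [lieDer_dForm _ hH, ← iotaMulti_apply] at hpH
  rw [dForm_add (v.iotaMulti_mem_smoothForms _ hH)
    (v.iotaMulti_mem_smoothForms p (dForm_mem_smoothForms hH)), hpH, lieDer, pow_succ,
    ← iotaMulti_apply, ← iotaMulti_apply]
  module

theorem IsLocallyPreserving.lieDer_multi_mem_exactForms (hloc : v.IsLocallyPreserving H) {i j : ℤ}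
    (hH : H ∈ Omega E M i) {k : ℕ} (hij : j + k = i + 1) {p : ⋀[ℝ]^k 𝔤}
    (hp : p ∈ boundaries 𝔤 k) : lieDer (v.multi p) H ∈ exactForms E M j := by
  obtain ⟨r, rfl⟩ := hp
  exact ⟨_, add_mem (v.iotaMulti_mem_Omega _ hH (by omega))
    (v.iotaMulti_mem_Omega r (dForm_mem_Omega hH rfl) (by push_cast; omega)),
    (hloc.lieDer_multi_boundary hH.1 r).symm⟩

/-- The map `p ↦ 𝓛_{v_p} H` from cycles to closed forms. -/
def IsLocallyPreserving.lieDerCycles (hloc : v.IsLocallyPreserving H) {i j : ℤ}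
    (hH : H ∈ Omega E M i) {k : ℕ} (hij : j + k = i + 1) : cycles 𝔤 k →ₗ[ℝ] closedForms E M j :=
  (v.lieDerMulti hH.1 k ∘ₗ (cycles 𝔤 k).subtype).codRestrict _ fun p =>
    ⟨v.lieDer_multi_mem_Omega _ hH hij, hloc.dForm_lieDer_multi_of_mem_cycles hH.1 p.2⟩

/-- The map `A : [p] ↦ [𝓛_{v_p} H]` from Lie algebra homology to de Rham cohomology. -/
def IsLocallyPreserving.lieDerHomology (hloc : v.IsLocallyPreserving H) {i j : ℤ}
    (hH : H ∈ Omega E M i) {k : ℕ} (hij : j + k = i + 1) :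
    LieHomology 𝔤 k →ₗ[ℝ] DeRham E M j :=
  Submodule.mapQ _ _ (hloc.lieDerCycles hH hij) fun _ hp =>
    hloc.lieDer_multi_mem_exactForms hH hij hp

end InfinitesimalAction

namespace IsLInftyMorphism

variable {n : ℕ} {ω₀ : TotalForm E M} {f : (i : ℕ) → (⋀[ℝ]^i 𝔤) →ₗ[ℝ] Omega E M ((n : ℤ) - i)}

theorem dForm_apply_of_boundary_eq_zero (hf : IsLInftyMorphism n ω₀ v f)
    (hω : ω₀ ∈ Omega E M (n + 1)) {k : ℕ} {p : ⋀[ℝ]^(k + 1) 𝔤} (hp : boundary 𝔤 k p = 0) :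
    dForm (f (k + 1) p : TotalForm E M) = -sgn (k + 1) • v.iotaMulti p ω₀ := by
  rcases le_or_gt k n with hk | hk
  · have h := hf.main k hk p
    rw [hp, map_zero, ZeroMemClass.coe_zero, neg_zero] at h
    exact (eq_neg_of_add_eq_zero_left h.symm).trans (neg_smul _ _).symm
  · have hfp : dForm (f (k + 1) p : TotalForm E M) = 0 :=
      eq_zero_of_mem_Omega_of_neg (by push_cast; omega) (dForm_mem_Omega (f (k + 1) p).2 rfl)
    have hιp : v.iotaMulti p ω₀ = 0 := eq_zero_of_mem_Omega_of_neg (j := n - k) (by omega)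
      (v.iotaMulti_mem_Omega p hω (by push_cast; ring))
    rw [hfp, hιp, smul_zero]

theorem iota_dForm_apply_of_boundary_eq_zero (hf : IsLInftyMorphism n ω₀ v f)
    (hω : ω₀ ∈ Omega E M (n + 1)) {X : VectorFields E M} (hX : IsHamiltonianVectorField ω₀ H X)
    {k : ℕ} {p : ⋀[ℝ]^(k + 1) 𝔤} (hp : boundary 𝔤 k p = 0) :
    iota (toMultivector X) (dForm (f (k + 1) p : TotalForm E M)) =
      ((-1 : ℝ) ^ (k + 1) * sgn (k + 1)) • v.iotaMulti p (dForm H) := by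
  rw [hf.dForm_apply_of_boundary_eq_zero hω hp, iota_smul, v.iotaMulti_apply,
    iota_toMultivector_comm, ← v.iotaMulti_apply, hX, map_neg]
  module

theorem lieDer_multi_add_sgn_smul_lieDer_apply (hf : IsLInftyMorphism n ω₀ v f)
    (hω : ω₀ ∈ Omega E M (n + 1)) (hH : H ∈ smoothForms E M) {X : VectorFields E M}
    (hX : IsHamiltonianVectorField ω₀ H X) {k : ℕ} {p : ⋀[ℝ]^(k + 1) 𝔤}
    (hp : boundary 𝔤 k p = 0) :
    lieDer (v.multi p) H + sgn (k + 1) • lieDer (toMultivector X) (f (k + 1) p) =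
      dForm (v.iotaMulti p H +
        sgn (k + 1) • iota (toMultivector X) (f (k + 1) p : TotalForm E M)) := by
  rw [dForm_add (v.iotaMulti_mem_smoothForms p hH) (Submodule.smul_mem _ _
    (iota_toMultivector_mem_smoothForms X (f (k + 1) p).2.1)), dForm_smul, lieDer_toMultivector,
    hf.iota_dForm_apply_of_boundary_eq_zero hω hX hp, lieDer, ← v.iotaMulti_apply,
    ← v.iotaMulti_apply, smul_add, smul_smul, mul_left_comm, sgn_mul_self]
  module

theorem lieDer_multi_add_sgn_smul_lieDer_apply_mem_exactForms (hf : IsLInftyMorphism n ω₀ v f)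
    (hω : ω₀ ∈ Omega E M (n + 1)) (hH : H ∈ Omega E M (n - 1)) {X : VectorFields E M}
    (hX : IsHamiltonianVectorField ω₀ H X) {k : ℕ} {p : ⋀[ℝ]^k 𝔤} (hp : p ∈ cycles 𝔤 k) :
    lieDer (v.multi p) H + sgn k • lieDer (toMultivector X) (f k p) ∈
      exactForms E M ((n : ℤ) - k) := by
  cases k with
  | zero =>
    have hfp : (f 0 p : TotalForm E M) = 0 := by rw [hf.f_zero]; rfl
    rw [v.lieDer_multi_zero p hH.1, hfp, lieDer_zero, smul_zero, add_zero]
    exact zero_mem _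
  | succ k =>
    refine ⟨_, add_mem (v.iotaMulti_mem_Omega p hH (by omega)) (Submodule.smul_mem _ _
      (iota_toMultivector_mem_Omega X (f (k + 1) p).2 (by ring))),
      (hf.lieDer_multi_add_sgn_smul_lieDer_apply hω hH.1 hX hp).symm⟩

end IsLInftyMorphism

end Momenta

end MultiSymp

end

open MultiSymp in
theorem mainTheorem8_general
    {E : Type*} [NormedAddCommGroup E] [NormedSpace ℝ E]
    {M : Type*} [TopologicalSpace M] [ChartedSpace E M] [IsManifold 𝓘(ℝ, E) ∞ M]
    {𝔤 : Type*} [LieRing 𝔤] [LieAlgebra ℝ 𝔤]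
    (n : ℕ) (ω₀ : TotalForm E M) (hω : ω₀ ∈ Omega E M (n + 1))
    (H : TotalForm E M) (hH : H ∈ Omega E M (n - 1))
    (v : InfinitesimalAction E M 𝔤) (hloc : v.IsLocallyPreserving H) (k : ℕ) :
    ∃ A : LieHomology 𝔤 k →ₗ[ℝ] DeRham E M ((n : ℤ) - k),
      (∀ p : cycles 𝔤 k,
        ∃ hcl : lieDer (v.multi (p : ⋀[ℝ]^k 𝔤)) H ∈ closedForms E M ((n : ℤ) - k),
          A (Subquotient.mk p) = Subquotient.mk ⟨lieDer (v.multi (p : ⋀[ℝ]^k 𝔤)) H, hcl⟩) ∧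
      (∀ vH : VectorFields E M, IsHamiltonianVectorField ω₀ H vH →
        ∀ f : (i : ℕ) → (⋀[ℝ]^i 𝔤) →ₗ[ℝ] Omega E M ((n : ℤ) - i), IsLInftyMorphism n ω₀ v f →
          ∀ p : cycles 𝔤 k,
            ∃ hcl : lieDer (toMultivector vH) (f k p) ∈ closedForms E M ((n : ℤ) - k),
              A (Subquotient.mk p) =
                -sgn k • Subquotient.mk ⟨lieDer (toMultivector vH) (f k p), hcl⟩) := by
  have degree : (n : ℤ) - k + k = n - 1 + 1 := by ring
  have lieDer_H_closed (p : cycles 𝔤 k) : lieDer (v.multi (p : ⋀[ℝ]^k 𝔤)) H ∈ closedForms E M _ :=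
    (hloc.lieDerCycles hH degree p).2
  refine ⟨hloc.lieDerHomology hH degree, fun p => ⟨lieDer_H_closed p, rfl⟩, fun vH hvH f hf p => ?_⟩
  have sum_exact := hf.lieDer_multi_add_sgn_smul_lieDer_apply_mem_exactForms hω hH hvH p.2
  have momentum_closed : lieDer (toMultivector vH) (f k p) ∈ closedForms E M ((n : ℤ) - k) := by
    have h := Submodule.smul_mem _ (sgn k)
      (sub_mem (exactForms_le_closedForms _ sum_exact) (lieDer_H_closed p))
    rwa [add_sub_cancel_left, smul_smul, sgn_mul_self, one_smul] at h
  refine ⟨momentum_closed, ?_⟩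
  rw [← map_smul]
  refine (Submodule.Quotient.eq _).2 (?_ : lieDer (v.multi (p : ⋀[ℝ]^k 𝔤)) H -
    -sgn k • lieDer (toMultivector vH) (f k p) ∈ exactForms E M _)
  convert sum_exact using 1
  module

open MultiSymp in
theorem mainTheorem8
    {E : Type*} [NormedAddCommGroup E] [NormedSpace ℝ E] [FiniteDimensional ℝ E]
    {M : Type*} [TopologicalSpace M] [ChartedSpace E M] [IsManifold 𝓘(ℝ, E) ∞ M]
    {𝔤 : Type*} [LieRing 𝔤] [LieAlgebra ℝ 𝔤]
    (n : ℕ) (ω₀ : TotalForm E M) (hω : IsPrePlectic n ω₀)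
    (H : TotalForm E M) (hH : IsHamiltonianForm n ω₀ H)
    (v : InfinitesimalAction E M 𝔤) (hv : v.IsMultisymplectic ω₀)
    (hloc : v.IsLocallyPreserving H)
    (k : ℕ) (hk : 1 ≤ k) :
    ∃ A : LieHomology 𝔤 k →ₗ[ℝ] DeRham E M ((n : ℤ) - k),
      (∀ p : cycles 𝔤 k,
        ∃ hcl : lieDer (v.multi (p : ⋀[ℝ]^k 𝔤)) H ∈ closedForms E M ((n : ℤ) - k),
          A (Subquotient.mk p) = Subquotient.mk ⟨lieDer (v.multi (p : ⋀[ℝ]^k 𝔤)) H, hcl⟩) ∧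
      (∀ vH : VectorFields E M, IsHamiltonianVectorField ω₀ H vH →
        ∀ f : (i : ℕ) → (⋀[ℝ]^i 𝔤) →ₗ[ℝ] Omega E M ((n : ℤ) - i), IsComomentum n ω₀ v f →
          ∀ p : cycles 𝔤 k,
            ∃ hcl : lieDer (toMultivector vH) (f k p) ∈ closedForms E M ((n : ℤ) - k),
              A (Subquotient.mk p) =
                -sgn k • Subquotient.mk ⟨lieDer (toMultivector vH) (f k p), hcl⟩) := by
  obtain ⟨A, hA, hA_momentum⟩ := mainTheorem8_general n ω₀ hω.1 H hH.1 v hloc k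
  exact ⟨A, hA, fun vH hvH f hf => hA_momentum vH hvH f hf.toIsLInftyMorphism⟩
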